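/- Let $G$ be a group and let $\cdots\to F_2\xrightarrow{d_2}F_1\xrightarrow{d_1}F_0\xrightarrow{\varepsilon}\mathbb Z\to 0$ be a free resolution of the trivial $\mathbb ZG$-module $\mathbb Z$ with chosen bases and a contracting homotopy $h$, that is, additive maps $h_{-1}:\mathbb Z\to F_0$ and $h_n:F_n\to F_{n+1}$ with $\varepsilon h_{-1}=1$, $h_{-1}\varepsilon+d_1h_0=1$ and $h_{n-1}d_n+d_{n+1}h_n=1$ for $n\ge 1$. Assume that the resolution is reduced: $F_0=\mathbb ZG$, with the single generator $1$. Let $\|\cdot\|:G\to\mathbb N$ be a norm, that is, $\|g\|=0$ if and only if $g=1$, and $\|g_1g_2\|\le\|g_1\|+\|g_2\|$. Assume that it is compatible with the resolution: there are values $\|z\|\in\mathbb N$ for the generators $z$ of all $F_n$, with $\|z\|=0$ for the generator of $F_0$, such that for the norms $\|\sum_i\lambda_i g_iz_i\|=\max_i(\|g_i\|+\|z_i\|)$ on $F_n$ (where $\lambda_i\neq 0$ and the pairs $(g_i,z_i)$ are distinct) and for every $n\ge 0$ there is $i_n\in\mathbb Z$ with $\|h_n(x)\|\le\|x\|-i_n$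 for all $x\in F_n$ with $h_n(x)\ne 0$ and $\|d_{n+1}(x')\|\le\|x'\|+i_n$ for all $x'\in F_{n+1}$ with $d_{n+1}(x')\neq 0$. *The effective homology.* Let $B_*$ be the normalized bar resolution of $G$, with its contracting homotopy $h'_{-1}(1)=[\,]$, $h'_n(g[g_1|\cdots|g_n])=[g|g_1|\cdots|g_n]$ and augmentation $\varepsilon'$, so that $\mathbb Z\otimes_{\mathbb ZG}B_*=C_*(K(G,1))$ is the normalized chain complex of $K(G,1)$. Define $\mathbb ZG$-linear maps on generators by $f_0=h_{-1}\varepsilon'$, $f_{n+1}=h_nf_nd$ ($f:B_*\to F_*$); $g_0=h'_{-1}\varepsilon$, $g_{n+1}=h'_ng_nd$ ($g:F_*\to B_*$); $k_0=h_0(1-fg)$, $k_{n+1}=h_{n+1}(1-fg-k_nd)$ on $F_*$; and $k'_0=h'_0(1-gf)$, $k'_{n+1}=h'_{n+1}(1-gf-k'_nd)$ on $B_*$. Apply $\mathbb Z\otimes_{\mathbb ZG}-$, put $C_*=C_*(K(G,1))$ and $E_*=\mathbb Z\otimes_{\mathbb ZG}F_*$, and let $D_*$ be the mapping cylinder of $f$: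 $D_n=C_n\oplus C_{n-1}\oplus E_n$ with $d(c,c',e)=(dc+c',-dc',de-fc')$. Put $$f_1(c,c',e)=c+k'c'+ge,\quad g_1(c)=(c,0,0),\quad f_2(c,c',e)=fc+e,\quad g_2(e)=(0,0,e),\quad h_2(c,c',e)=(0,c,0),$$ and $h_1=\eta d\eta$, where $\eta(c,c',e)=(k'y-gv,-y,v)$, $y=k'c'+ge$, $v=ke-(kf-fk')y$. *Claim 1.* $\rho_1=(f_1,g_1,h_1):D_*\Rightarrow C_*(K(G,1))$ and $\rho_2=(f_2,g_2,h_2):D_*\Rightarrow E_*$ are reductions, that is, they form a strong chain equivalence between $C_*(K(G,1))$ and $E_*$; and for every $n\ge 1$ the endomorphism $h_2g_1\partial_nf_1$ of $D_n$ is locally nilpotent, where $\partial_n[g_1|\cdots|g_n]=[g_1|\cdots|g_{n-1}]$ is the last face, extended linearly from the nondegenerate simplices. *Claim 2.* Let $\delta$ be the perturbation $\delta(g\otimes[g_1|\cdots|g_n])=(-1)^n(gg_n^{-1}-g)\otimes[g_1|\cdots|g_{n-1}]$ of the differential of $\mathbb ZG\otimes C_*(K(G,1))$, which turns it into the chain complex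 $\mathbb ZG\otimes_tC_*(K(G,1))$ of the universal bundle over $K(G,1)$, and write the maps of $\rho_1,\rho_2$ also for their extensions to $\mathbb ZG\otimes-$. Then $h_2g_1\delta f_1$ is locally nilpotent on $\mathbb ZG\otimes D_n$ for $n\geq1$. Put $\delta_D=g_1\delta f_1$, $\Phi=\sum_{i\ge 0}(-1)^i(h_2\delta_D)^i$, $f_2^t=f_2(1-\delta_D\Phi h_2)$, $g_2^t=\Phi g_2$. The modules $F'_n=\mathbb ZG\otimes E_n$ with the differential, augmentation and contracting homotopy $$d'=d_E+f_2\delta_D\Phi g_2,\qquad \varepsilon'_{new}=\varepsilon_tf_1g_2^t,\qquad h'_{new,-1}=f_2^tg_1\eta_t,\qquad h'_{new}=f_2^t(h_1+g_1sf_1)g_2^t,$$ where $\varepsilon_t(g\otimes[\,])=1$, $\eta_t(1)=1\otimes[\,]$ and $s(g\otimes[g_1|\cdots|g_n])=(-1)^{n+1}\,1\otimes[g_1|\cdots|g_n|g^{-1}]$, form a free resolution of $\mathbb Z$ over $\mathbb ZG$ with contracting homotopy. It has the same modules as before: $1\otimes z\mapsto z$ on generators defines an isomorphism $F'_n\cong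 F_n$. If each $F_n$ has finitely many generators, then $E_*$ and $F'_*$ are of finite type. -/

import Mathlib

open scoped TensorProduct

noncomputable section

universe u v w

namespace EffHom

/-! ## Group rings and augmented complexes with contracting homotopies -/

/-- The integral group ring of `G`. -/
abbrev ZG (G : Type u) [Group G] : Type u := MonoidAlgebra ℤ G

/-- The augmentation `∑ λ_g g ↦ ∑ λ_g`. -/
def aug (G : Type u) [Group G] : ZG G →ₐ[ℤ] ℤ := MonoidAlgebra.lift ℤ ℤ G 1

/-- The additive map on words `∑ λ (g, x)` of the free `ℤG`-module on `X` that sends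
`(g, x)` to `φ g x`. -/
def wordsLift {G : Type u} [Group G] {X : Type v} {M : Type w} [AddCommGroup M]
    (φ : G → X → M) : (X →₀ ZG G) →+ M :=
  Finsupp.liftAddHom fun x =>
    (Finsupp.liftAddHom fun g => zmultiplesHom M (φ g x)).comp
      MonoidAlgebra.coeffAddEquiv.toAddMonoidHom

/-- The maps of an augmented complex of `ℤG`-modules `⋯ → F 1 → F 0 → ℤ` together with those of a
contracting homotopy: `d n : F (n+1) → F n`, the augmentation `ε : F 0 → ℤ`, the map
`hneg : ℤ → F 0` (in degree `-1`) and `h n : F n → F (n+1)`. -/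
structure ResData (G : Type u) [Group G] (F : ℕ → Type v) [∀ n, AddCommGroup (F n)]
    [∀ n, Module (ZG G) (F n)] where
  d : ∀ n, F (n + 1) →ₗ[ZG G] F n
  ε : F 0 →+ ℤ
  hneg : ℤ →+ F 0
  h : ∀ n, F n →+ F (n + 1)

/-- The maps form a free resolution of the trivial `ℤG`-module `ℤ` with a contracting homotopy
(whose existence gives the exactness). -/
structure ResData.IsFreeResolution {G : Type u} [Group G] {F : ℕ → Type v}
    [∀ n, AddCommGroup (F n)] [∀ n, Module (ZG G) (F n)] (R : ResData G F) : Prop where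
  free : ∀ n, Module.Free (ZG G) (F n)
  ε_smul : ∀ (a : ZG G) (x : F 0), R.ε (a • x) = aug G a * R.ε x
  ε_d : ∀ x, R.ε (R.d 0 x) = 0
  d_d : ∀ n x, R.d n (R.d (n + 1) x) = 0
  ε_hneg : ∀ m, R.ε (R.hneg m) = m
  homotopy_zero : ∀ x, R.hneg (R.ε x) + R.d 0 (R.h 0 x) = x
  homotopy_succ : ∀ n x, R.h n (R.d n x) + R.d (n + 1) (R.h (n + 1) x) = x

/-! ## Norms -/

/-- A norm on a group. -/
def IsGroupNorm {G : Type u} [Group G] (N : G → ℕ) : Prop :=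
  (∀ g, N g = 0 ↔ g = 1) ∧ ∀ g₁ g₂, N (g₁ * g₂) ≤ N g₁ + N g₂

/-- The norm on a free `ℤG`-module with basis `b` which is determined by the norm `N` of `G` and
the norms `ν z` of the generators: `‖∑ λ_i (g_i, z_i)‖ = max (‖g_i‖ + ‖z_i‖)`, where the `λ_i` are
nonzero and the `(g_i, z_i)` distinct. -/
def freeNorm {G : Type u} [Group G] {Z : Type w} {M : Type v} [AddCommGroup M] [Module (ZG G) M]
    (b : Module.Basis Z (ZG G) M) (N : G → ℕ) (ν : Z → ℕ) (x : M) : ℕ :=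
  (b.repr x).support.sup fun z => (b.repr x z).coeff.support.sup fun g => N g + ν z

/-- The norm `N` of `G` is compatible with the resolution `R` and its contracting homotopy, with
respect to the bases `b` (in degree `0` the generators have norm `0`). The estimates are
required for nonzero values only, `0` having no words. -/
def NormCompatible {G : Type u} [Group G] {F : ℕ → Type v} [∀ n, AddCommGroup (F n)]
    [∀ n, Module (ZG G) (F n)] {Z : ℕ → Type w} (b : ∀ n, Module.Basis (Z n) (ZG G) (F n))
    (R : ResData G F) (N : G → ℕ) : Prop :=
  ∃ ν : ∀ n, Z n → ℕ, (∀ z, ν 0 z = 0) ∧ ∀ n, ∃ i : ℤ,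
    (∀ x : F n, R.h n x ≠ 0 →
      (freeNorm (b (n + 1)) N (ν (n + 1)) (R.h n x) : ℤ) ≤ freeNorm (b n) N (ν n) x - i) ∧
    (∀ x : F (n + 1), R.d n x ≠ 0 →
      (freeNorm (b n) N (ν n) (R.d n x) : ℤ) ≤ freeNorm (b (n + 1)) N (ν (n + 1)) x + i)

/-! ## Reductions and strong chain equivalences -/

section Reductions

variable {C : ℕ → Type u} {D : ℕ → Type v} {E : ℕ → Type w}
  [∀ n, AddCommGroup (C n)]
  [∀ n, AddCommGroup (D n)]
  [∀ n, AddCommGroup (E n)]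

/-- `d n : C (n+1) → C n` is the differential of a chain complex. -/
def IsDifferential (d : ∀ n, C (n + 1) →ₗ[ℤ] C n) : Prop := ∀ n x, d n (d (n + 1) x) = 0

variable (C D) in
/-- The three maps of a reduction `C ⇒ D`. -/
structure RedData where
  f : ∀ n, C n →ₗ[ℤ] D n
  g : ∀ n, D n →ₗ[ℤ] C n
  h : ∀ n, C n →ₗ[ℤ] C (n + 1)

/-- The axioms of a reduction from the complex `(C, dC)` to the complex `(D, dD)`. -/
structure RedData.IsReduction (ρ : RedData C D) (dC : ∀ n, C (n + 1) →ₗ[ℤ] C n)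
    (dD : ∀ n, D (n + 1) →ₗ[ℤ] D n) : Prop where
  f_d : ∀ n x, ρ.f n (dC n x) = dD n (ρ.f (n + 1) x)
  g_d : ∀ n y, ρ.g n (dD n y) = dC n (ρ.g (n + 1) y)
  f_g : ∀ n y, ρ.f n (ρ.g n y) = y
  homotopy_zero : ∀ x, dC 0 (ρ.h 0 x) = x - ρ.g 0 (ρ.f 0 x)
  homotopy_succ : ∀ n x,
    dC (n + 1) (ρ.h (n + 1) x) + ρ.h n (dC n x) = x - ρ.g (n + 1) (ρ.f (n + 1) x)
  f_h : ∀ n x, ρ.f (n + 1) (ρ.h n x) = 0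
  h_g : ∀ n y, ρ.h n (ρ.g n y) = 0
  h_h : ∀ n x, ρ.h (n + 1) (ρ.h n x) = 0

variable (C D E) in
/-- The data of a strong chain equivalence `C ⇐ D ⇒ E`: the differential of the complex `D` in
the middle and the two reductions `ρ₁ = (f₁, g₁, h₁)` and `ρ₂ = (f₂, g₂, h₂)`. -/
structure EquivData where
  dD : ∀ n, D (n + 1) →ₗ[ℤ] D n
  ρ₁ : RedData D C
  ρ₂ : RedData D E

/-- The axioms of a strong chain equivalence between `(C, dC)` and `(E, dE)`. -/
structure EquivData.IsStrongEquiv (η : EquivData C D E) (dC : ∀ n, C (n + 1) →ₗ[ℤ] C n)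
    (dE : ∀ n, E (n + 1) →ₗ[ℤ] E n) : Prop where
  dC_isDifferential : IsDifferential dC
  dD_isDifferential : IsDifferential η.dD
  dE_isDifferential : IsDifferential dE
  ρ₁_isReduction : η.ρ₁.IsReduction η.dD dC
  ρ₂_isReduction : η.ρ₂.IsReduction η.dD dE

end Reductions

/-! ## The mapping cylinder of a homotopy equivalence -/

/-- The shifted graded module: `C (n-1)` in degree `n`, and `0` in degree `0`. -/
def Shift (C : ℕ → Type u) : ℕ → Type u
  | 0 => PUnit
  | n + 1 => C n

instance Shift.instAddCommGroup (C : ℕ → Type u) [∀ n, AddCommGroup (C n)] :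
    ∀ n, AddCommGroup (Shift C n)
  | 0 => inferInstanceAs (AddCommGroup PUnit)
  | n + 1 => inferInstanceAs (AddCommGroup (C n))

section Cylinder

variable {C : ℕ → Type u} {E : ℕ → Type v}
  [∀ n, AddCommGroup (C n)]
  [∀ n, AddCommGroup (E n)]

/-- The identification of `Shift C (n+1)` with `C n`. -/
def Shift.unshift (n : ℕ) : Shift C (n + 1) ≃ₗ[ℤ] C n := LinearEquiv.refl ℤ (C n)

/-- A map out of `C (n-1)`, extended by `0` for `n = 0`. -/
def Shift.desc {M : ℕ → Type w} [∀ n, AddCommGroup (M n)]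
    (φ : ∀ n, C n →ₗ[ℤ] M (n + 1)) : ∀ n, Shift C n →ₗ[ℤ] M n
  | 0 => 0
  | n + 1 => φ n ∘ₗ (Shift.unshift n).toLinearMap

/-- The differential `C n → C (n-1)`, which is `0` for `n = 0`. -/
def Shift.diff (d : ∀ n, C (n + 1) →ₗ[ℤ] C n) : ∀ n, C n →ₗ[ℤ] Shift C n
  | 0 => 0
  | n + 1 => (Shift.unshift n).symm.toLinearMap ∘ₗ d n

variable (C E) in
/-- The modules `C n ⊕ C (n-1) ⊕ E n` of the mapping cylinder of a chain map `C → E`. -/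
abbrev Cyl (n : ℕ) : Type (max u v) := C n × Shift C n × E n

variable (C E) in
/-- The first coordinate of the cylinder. -/
def Cyl.p₁ (n : ℕ) : Cyl C E n →ₗ[ℤ] C n := LinearMap.fst ℤ _ _

variable (C E) in
/-- The second coordinate of the cylinder. -/
def Cyl.p₂ (n : ℕ) : Cyl C E n →ₗ[ℤ] Shift C n := LinearMap.fst ℤ _ _ ∘ₗ LinearMap.snd ℤ _ _

variable (C E) in
/-- The second coordinate of the cylinder in a positive degree. -/
def Cyl.p₂' (n : ℕ) : Cyl C E (n + 1) →ₗ[ℤ] C n :=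
  (Shift.unshift n).toLinearMap ∘ₗ Cyl.p₂ C E (n + 1)

variable (C E) in
/-- The third coordinate of the cylinder. -/
def Cyl.p₃ (n : ℕ) : Cyl C E n →ₗ[ℤ] E n := LinearMap.snd ℤ _ _ ∘ₗ LinearMap.snd ℤ _ _

/-- The differential `(c, c', e) ↦ (d c + c', - d c', d e - f c')` of the mapping cylinder of
`f : C → E`. -/
def cylDiff (dC : ∀ n, C (n + 1) →ₗ[ℤ] C n) (dE : ∀ n, E (n + 1) →ₗ[ℤ] E n)
    (f : ∀ n, C n →ₗ[ℤ] E n) (n : ℕ) : Cyl C E (n + 1) →ₗ[ℤ] Cyl C E n :=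
  (dC n ∘ₗ Cyl.p₁ C E (n + 1) + Cyl.p₂' C E n).prod
    ((-(Shift.diff dC n ∘ₗ Cyl.p₂' C E n)).prod
      (dE n ∘ₗ Cyl.p₃ C E (n + 1) - f n ∘ₗ Cyl.p₂' C E n))

/-- The maps `f₂ (c, c', e) = f c + e`, `g₂ e = (0, 0, e)`, `h₂ (c, c', e) = (0, c, 0)` of the
reduction from the mapping cylinder of `f : C → E` to `E`. -/
def cylRight (f : ∀ n, C n →ₗ[ℤ] E n) : RedData (Cyl C E) E where
  f n := f n ∘ₗ Cyl.p₁ C E n + Cyl.p₃ C E n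
  g n := (0 : E n →ₗ[ℤ] C n).prod ((0 : E n →ₗ[ℤ] Shift C n).prod LinearMap.id)
  h n := (0 : Cyl C E n →ₗ[ℤ] C (n + 1)).prod
    (((Shift.unshift n).symm.toLinearMap ∘ₗ Cyl.p₁ C E n).prod (0 : Cyl C E n →ₗ[ℤ] E (n + 1)))

/-- For a homotopy equivalence `f : C → E`, `g : E → C` with homotopies `k'` on `C` and `k` on `E`,
`d k' + k' d = 1 - g f` and `d k + k d = 1 - f g`, this is the homotopy
`(c, c', e) ↦ (k' y - g v, -y, v)` on the mapping cylinder, where `y = k' c' + g e` and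
`v = k e - (k f - f k') y`. -/
def cylHomotopy (f : ∀ n, C n →ₗ[ℤ] E n) (g : ∀ n, E n →ₗ[ℤ] C n)
    (k : ∀ n, E n →ₗ[ℤ] E (n + 1)) (k' : ∀ n, C n →ₗ[ℤ] C (n + 1)) (n : ℕ) :
    Cyl C E n →ₗ[ℤ] Cyl C E (n + 1) :=
  let y : Cyl C E n →ₗ[ℤ] C n := Shift.desc k' n ∘ₗ Cyl.p₂ C E n + g n ∘ₗ Cyl.p₃ C E n
  let v : Cyl C E n →ₗ[ℤ] E (n + 1) :=
    k n ∘ₗ Cyl.p₃ C E n - (k n ∘ₗ f n - f (n + 1) ∘ₗ k' n) ∘ₗ y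
  (k' n ∘ₗ y - g (n + 1) ∘ₗ v).prod ((-((Shift.unshift n).symm.toLinearMap ∘ₗ y)).prod v)

/-- The maps of the reduction from the mapping cylinder of a homotopy equivalence `f : C → E` to
`C`: `f₁ (c, c', e) = c + k' c' + g e`, `g₁ c = (c, 0, 0)`, and `h₁ = η d η` where `η` is
`cylHomotopy` (the composite with `d` makes `h₁ h₁ = 0`). -/
def cylLeft (dC : ∀ n, C (n + 1) →ₗ[ℤ] C n) (dE : ∀ n, E (n + 1) →ₗ[ℤ] E n)
    (f : ∀ n, C n →ₗ[ℤ] E n) (g : ∀ n, E n →ₗ[ℤ] C n)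
    (k : ∀ n, E n →ₗ[ℤ] E (n + 1)) (k' : ∀ n, C n →ₗ[ℤ] C (n + 1)) : RedData (Cyl C E) C where
  f n := Cyl.p₁ C E n + Shift.desc k' n ∘ₗ Cyl.p₂ C E n + g n ∘ₗ Cyl.p₃ C E n
  g n := LinearMap.inl ℤ (C n) (Shift C n × E n)
  h n := cylHomotopy f g k k' n ∘ₗ cylDiff dC dE f n ∘ₗ cylHomotopy f g k k' n

/-- The strong chain equivalence `C ⇐ Cyl f ⇒ E` obtained from a homotopy equivalence. -/
def cylEquiv (dC : ∀ n, C (n + 1) →ₗ[ℤ] C n) (dE : ∀ n, E (n + 1) →ₗ[ℤ] E n)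
    (f : ∀ n, C n →ₗ[ℤ] E n) (g : ∀ n, E n →ₗ[ℤ] C n)
    (k : ∀ n, E n →ₗ[ℤ] E (n + 1)) (k' : ∀ n, C n →ₗ[ℤ] C (n + 1)) :
    EquivData C (Cyl C E) E where
  dD := cylDiff dC dE f
  ρ₁ := cylLeft dC dE f g k k'
  ρ₂ := cylRight f

end Cylinder

/-! ## The space `K(G,1)` and the bar resolution -/

section Bar

variable (G : Type u) [Group G]

/-- The nondegenerate `n`-simplices `[g₁|⋯|gₙ]`, `gᵢ ≠ 1`, of `K(G,1)`. -/
abbrev Simp (n : ℕ) : Type u := {x : Fin n → G // ∀ i, x i ≠ 1}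

/-- The normalized chains of `K(G,1)`. -/
abbrev Chains (n : ℕ) : Type u := Simp G n →₀ ℤ

/-- The `n`-th module of the (normalized) bar resolution. -/
abbrev Bar (n : ℕ) : Type u := Simp G n →₀ ZG G

variable {G}

/-- The faces of `K(G,1)`: `∂₀` omits `g₁`, the last face omits the last entry, and the
others multiply two neighbours. -/
def face {n : ℕ} (i : Fin (n + 2)) (x : Fin (n + 1) → G) : Fin n → G :=
  Fin.cases (fun j => x j.succ) (fun j => Fin.contractNth j (· * ·) x) i

open Classical in
/-- The normalized chain of a simplex of `K(G,1)`, zero if the simplex is degenerate. -/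
def nchain {n : ℕ} (x : Fin n → G) : Chains G n :=
  if hx : ∀ i, x i ≠ 1 then Finsupp.single ⟨x, hx⟩ 1 else 0

open Classical in
/-- The element `a [g₁|⋯|gₙ]` of the bar resolution, zero if some `gᵢ` is `1`. -/
def barElt {n : ℕ} (a : ZG G) (x : Fin n → G) : Bar G n :=
  if hx : ∀ i, x i ≠ 1 then Finsupp.single ⟨x, hx⟩ a else 0

variable (G)

/-- The `i`-th face, extended to the normalized chains by linearity on the nondegenerate
simplices. -/
def faceMap (n : ℕ) (i : Fin (n + 2)) : Chains G (n + 1) →ₗ[ℤ] Chains G n :=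
  Finsupp.linearCombination ℤ fun x => nchain (face i x.1)

/-- The last face `∂ₙ₊₁ : Cₙ₊₁(K(G,1)) → Cₙ(K(G,1))`. -/
def lastFace (n : ℕ) : Chains G (n + 1) →ₗ[ℤ] Chains G n := faceMap G n (Fin.last (n + 1))

/-- The differential of the normalized chain complex `C_*(K(G,1))`. -/
def chainDiff (n : ℕ) : Chains G (n + 1) →ₗ[ℤ] Chains G n :=
  ∑ i : Fin (n + 2), (-1 : ℤ) ^ (i : ℕ) • faceMap G n i

/-- The differential of the bar resolution:
`d [g₁|⋯|gₙ₊₁] = g₁ [g₂|⋯|gₙ₊₁] + ∑_{i > 0} (-1)^i ∂ᵢ [g₁|⋯|gₙ₊₁]`. -/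
def barDiff (n : ℕ) : Bar G (n + 1) →ₗ[ZG G] Bar G n :=
  Finsupp.linearCombination (ZG G) fun x =>
    barElt (MonoidAlgebra.of ℤ G (x.1 0)) (face 0 x.1) +
      ∑ j : Fin (n + 1), (-1 : ℤ) ^ ((j : ℕ) + 1) • barElt 1 (face j.succ x.1)

/-- The bar resolution, with `ε' (g []) = 1`, `h'_{-1} 1 = []` and
`h' (g [g₁|⋯|gₙ]) = [g|g₁|⋯|gₙ]`. -/
def barRes : ResData G (Bar G) where
  d := barDiff G
  ε := wordsLift fun _ _ => 1
  hneg := zmultiplesHom _ (barElt 1 Fin.elim0)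
  h _ := wordsLift fun g x => barElt 1 (Fin.cons g x.1)

/-- The basis of the `n`-th module of the bar resolution. -/
def barBasis (n : ℕ) : Module.Basis (Simp G n) (ZG G) (Bar G n) := Finsupp.basisSingleOne

end Bar

/-! ## The effective homology of `K(G,1)` obtained from a resolution -/

section FromResolution

variable {G : Type u} [Group G]
  {P : ℕ → Type v} [∀ n, AddCommGroup (P n)] [∀ n, Module (ZG G) (P n)]
  {Z : ℕ → Type w} (b : ∀ n, Module.Basis (Z n) (ZG G) (P n))

/-- The `ℤG`-linear comparison map from a free resolution `P` with bases `b` to a resolution `Q`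
with contracting homotopy `h`: on generators, `φ₀ z = h_{-1} ε z` and `φₙ₊₁ z = hₙ φₙ d z`. -/
def compare (R : ResData G P) {Q : ℕ → Type*} [∀ n, AddCommGroup (Q n)]
    [∀ n, Module (ZG G) (Q n)] (S : ResData G Q) : ∀ n, P n →ₗ[ZG G] Q n
  | 0 => (b 0).constr ℤ fun z => S.hneg (R.ε (b 0 z))
  | n + 1 => (b (n + 1)).constr ℤ fun z => S.h n (compare R S n (R.d n (b (n + 1) z)))

/-- The `ℤG`-linear homotopy between the identity and an endomorphism `ψ` of a free resolution
with contracting homotopy `h`: on generators, `k₀ z = h₀ (z - ψ z)` and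
`kₙ₊₁ z = hₙ₊₁ (z - ψ z - kₙ d z)`. -/
def homotopyTo (R : ResData G P) (ψ : ∀ n, P n →ₗ[ZG G] P n) : ∀ n, P n →ₗ[ZG G] P (n + 1)
  | 0 => (b 0).constr ℤ fun z => R.h 0 (b 0 z - ψ 0 (b 0 z))
  | n + 1 => (b (n + 1)).constr ℤ fun z =>
      R.h (n + 1) (b (n + 1) z - ψ (n + 1) (b (n + 1) z) - homotopyTo R ψ n (R.d n (b (n + 1) z)))

/-- The map induced by a `ℤG`-linear map `φ : M → N` of free modules on `ℤ ⊗_{ℤG} -`; for a free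
module with basis indexed by `X`, `ℤ ⊗_{ℤG} M` is the free abelian group `X →₀ ℤ`. -/
def coinv {M : Type*} {N : Type*} [AddCommGroup M] [Module (ZG G) M] [AddCommGroup N]
    [Module (ZG G) N] {X : Type*} {Y : Type*} (bM : Module.Basis X (ZG G) M)
    (bN : Module.Basis Y (ZG G) N) (φ : M →ₗ[ZG G] N) : (X →₀ ℤ) →ₗ[ℤ] (Y →₀ ℤ) :=
  Finsupp.linearCombination ℤ fun x =>
    Finsupp.mapRange (aug G) (map_zero _) (bN.repr (φ (bM x)))

/-- The differential of `E_* = ℤ ⊗_{ℤG} P_*`. -/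
def coinvDiff (R : ResData G P) (n : ℕ) : (Z (n + 1) →₀ ℤ) →ₗ[ℤ] (Z n →₀ ℤ) :=
  coinv (b (n + 1)) (b n) (R.d n)

/-- The strong chain equivalence `C_*(K(G,1)) ⇐ Cyl ⇒ ℤ ⊗_{ℤG} P_*` obtained from a free resolution
`P_*` with contracting homotopy: `f : Bar → P` and `g : P → Bar` are the comparison maps, `k` and
`k'` the homotopies from `1` to `f g` and `g f`, and the equivalence is the one of the mapping
cylinder of the map induced by `f` on `ℤ ⊗_{ℤG} -`. -/
def effHom (R : ResData G P) :
    EquivData (Chains G) (Cyl (Chains G) fun n => Z n →₀ ℤ) (fun n => Z n →₀ ℤ) :=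
  let f := compare (barBasis G) (barRes G) R
  let g := compare b R (barRes G)
  let k := homotopyTo b R fun n => f n ∘ₗ g n
  let k' := homotopyTo (barBasis G) (barRes G) fun n => g n ∘ₗ f n
  cylEquiv (chainDiff G) (coinvDiff b R)
    (fun n => coinv (barBasis G n) (b n) (f n))
    (fun n => coinv (b n) (barBasis G n) (g n))
    (fun n => coinv (b n) (b (n + 1)) (k n))
    (fun n => coinv (barBasis G n) (barBasis G (n + 1)) (k' n))

end FromResolution

/-! ## The resolution obtained from the effective homology of `K(G,1)` -/

/-- Local nilpotency of an endomorphism. -/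
def LocallyNilpotent {A : Type u} {M : Type v} [Semiring A] [AddCommMonoid M] [Module A M]
    (α : M →ₗ[A] M) : Prop :=
  ∀ x, ∃ m : ℕ, α^[m] x = 0

/-- The sum `1 - α + α² - ⋯`, for a locally nilpotent `α`. -/
def altSum {A : Type u} {M : Type v} [Ring A] [AddCommGroup M] [Module A M]
    (α : M →ₗ[A] M) (hα : LocallyNilpotent α) : M →ₗ[A] M :=
  have fin : ∀ x, (Function.support fun i : ℕ => ((-α) ^ i) x).Finite := by
    intro x
    obtain ⟨m, hm⟩ := hα x
    refine (Set.finite_Iio m).subset fun i hi => ?_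
    by_contra hlt
    obtain ⟨j, rfl⟩ := Nat.exists_eq_add_of_le (not_lt.mp hlt)
    refine hi ?_
    have h0 : (α ^ m) x = 0 := by rw [Module.End.pow_apply]; exact hm
    change ((-α) ^ (m + j)) x = 0
    rw [neg_pow, add_comm m j, pow_add α]
    simp [h0]
  { toFun := fun x => ∑ᶠ i : ℕ, ((-α) ^ i) x
    map_add' := fun x y => by
      simp only [map_add]
      exact finsum_add_distrib (fin x) (fin y)
    map_smul' := fun a x => by
      simp only [map_smul, RingHom.id_apply]
      exact (smul_finsum' a (fin x)).symm }

section ToResolution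

variable (G : Type u) [Group G]

open Classical in
/-- The augmentation `g ⊗ [] ↦ 1` of `ℤG ⊗_t C_*(K(G,1))`. -/
def twEps : ZG G ⊗[ℤ] Chains G 0 →+ ℤ :=
  (wordsLift fun _ _ => 1).comp
    (TensorProduct.finsuppScalarRight ℤ (ZG G) (ZG G) (Simp G 0)).toAddMonoidHom

open Classical in
/-- The contracting homotopy `g ⊗ [g₁|⋯|gₙ] ↦ (-1)^(n+1) 1 ⊗ [g₁|⋯|gₙ|g⁻¹]` of
`ℤG ⊗_t C_*(K(G,1))`. -/
def twHomotopy (n : ℕ) : ZG G ⊗[ℤ] Chains G n →+ ZG G ⊗[ℤ] Chains G (n + 1) :=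
  (wordsLift fun (g : G) (x : Simp G n) =>
      (-1 : ℤ) ^ (n + 1) • ((1 : ZG G) ⊗ₜ[ℤ] (nchain (Fin.snoc x.1 g⁻¹) : Chains G (n + 1)))).comp
    (TensorProduct.finsuppScalarRight ℤ (ZG G) (ZG G) (Simp G n)).toAddMonoidHom

open Classical in
/-- The perturbation that changes the differential of `ℤG ⊗ C_*(K(G,1))` into the one of
`ℤG ⊗_t C_*(K(G,1))`, the chain complex of the universal bundle `K(G,0) ×_τ K(G,1)`. The last face
of that space is `(g, [g₁|⋯|gₙ₊₁]) ↦ (g gₙ₊₁⁻¹, [g₁|⋯|gₙ])`, the other faces are those of the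
product, and so the perturbation is
`g ⊗ [g₁|⋯|gₙ₊₁] ↦ (-1)^(n+1) (g gₙ₊₁⁻¹ - g) ⊗ [g₁|⋯|gₙ]`. -/
def twPert (n : ℕ) : ZG G ⊗[ℤ] Chains G (n + 1) →ₗ[ZG G] ZG G ⊗[ℤ] Chains G n :=
  (Finsupp.linearCombination (ZG G) fun x : Simp G (n + 1) =>
      (-1 : ℤ) ^ (n + 1) • ((MonoidAlgebra.of ℤ G (x.1 (Fin.last n))⁻¹ - 1) ⊗ₜ[ℤ]
        lastFace G n (Finsupp.single x 1))) ∘ₗ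
    (TensorProduct.finsuppScalarRight ℤ (ZG G) (ZG G) (Simp G (n + 1))).toLinearMap

variable {G}
variable {D : ℕ → Type v} {E : ℕ → Type w}
  [∀ n, AddCommGroup (D n)]
  [∀ n, AddCommGroup (E n)]

/-- The perturbation `g₁ δ f₁` of the differential of `ℤG ⊗ D`, where `δ` is `twPert`. -/
def midPert (η : EquivData (Chains G) D E) (n : ℕ) :
    ZG G ⊗[ℤ] D (n + 1) →ₗ[ZG G] ZG G ⊗[ℤ] D n :=
  (η.ρ₁.g n).baseChange (ZG G) ∘ₗ twPert G n ∘ₗ (η.ρ₁.f (n + 1)).baseChange (ZG G)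

/-- The endomorphism `h₂ g₁ δ f₁` of `ℤG ⊗ D` whose local nilpotency is the hypothesis of the
perturbation lemma. -/
def pertEnd (η : EquivData (Chains G) D E) (n : ℕ) :
    ZG G ⊗[ℤ] D (n + 1) →ₗ[ZG G] ZG G ⊗[ℤ] D (n + 1) :=
  (η.ρ₂.h n).baseChange (ZG G) ∘ₗ midPert η n

/-- The series `∑ (-1)^i (h₂ g₁ δ f₁)^i` of the perturbation lemma. -/
def pertSeries (η : EquivData (Chains G) D E) (hη : ∀ n, LocallyNilpotent (pertEnd η n)) :
    ∀ n, ZG G ⊗[ℤ] D n →ₗ[ZG G] ZG G ⊗[ℤ] D n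
  | 0 => LinearMap.id
  | n + 1 => altSum (pertEnd η n) (hη n)

/-- The map `g` of the perturbed reduction `ℤG ⊗_t D ⇒ ℤG ⊗_t E`. -/
def pertG (η : EquivData (Chains G) D E) (hη : ∀ n, LocallyNilpotent (pertEnd η n)) (n : ℕ) :
    ZG G ⊗[ℤ] E n →ₗ[ZG G] ZG G ⊗[ℤ] D n :=
  pertSeries η hη n ∘ₗ (η.ρ₂.g n).baseChange (ZG G)

/-- The map `f` of the perturbed reduction `ℤG ⊗_t D ⇒ ℤG ⊗_t E`. -/
def pertF (η : EquivData (Chains G) D E) (hη : ∀ n, LocallyNilpotent (pertEnd η n)) (n : ℕ) :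
    ZG G ⊗[ℤ] D n →ₗ[ZG G] ZG G ⊗[ℤ] E n :=
  (η.ρ₂.f n).baseChange (ZG G) ∘ₗ (LinearMap.id -
    midPert η n ∘ₗ pertSeries η hη (n + 1) ∘ₗ (η.ρ₂.h n).baseChange (ZG G))

/-- The augmented complex `ℤG ⊗_t E` with contracting homotopy obtained from a strong chain
equivalence `C_*(K(G,1)) ⇐ D ⇒ E`: the differential is the perturbed one,
`d + f₂ (g₁ δ f₁) (∑ (-1)^i (h₂ g₁ δ f₁)^i) g₂`, and the contraction of `ℤG ⊗_t C_*(K(G,1))` is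
carried along the perturbed equivalence
`ℤG ⊗_t C_*(K(G,1)) ⇐ ℤG ⊗_t D ⇒ ℤG ⊗_t E`. -/
def newRes (η : EquivData (Chains G) D E) (dE : ∀ n, E (n + 1) →ₗ[ℤ] E n)
    (hη : ∀ n, LocallyNilpotent (pertEnd η n)) : ResData G (fun n => ZG G ⊗[ℤ] E n) where
  d n := (dE n).baseChange (ZG G) +
    (η.ρ₂.f n).baseChange (ZG G) ∘ₗ midPert η n ∘ₗ pertG η hη (n + 1)
  ε := (twEps G).comp
    (((η.ρ₁.f 0).baseChange (ZG G)).toAddMonoidHom.comp (pertG η hη 0).toAddMonoidHom)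
  hneg := zmultiplesHom _
    (pertF η hη 0 ((η.ρ₁.g 0).baseChange (ZG G) (1 ⊗ₜ[ℤ] nchain Fin.elim0)))
  h n := (pertF η hη (n + 1)).toAddMonoidHom.comp
    ((((η.ρ₁.h n).baseChange (ZG G)).toAddMonoidHom +
        ((η.ρ₁.g (n + 1)).baseChange (ZG G)).toAddMonoidHom.comp
          ((twHomotopy G n).comp ((η.ρ₁.f n).baseChange (ZG G)).toAddMonoidHom)).comp
      (pertG η hη n).toAddMonoidHom)

end ToResolution

end EffHom

end

open scoped TensorProduct

noncomputable section

universe u v w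

namespace EffHom

/-! ### Coinvariants of free modules -/

section Coinvariants

variable {G : Type*} [Group G] {M N : Type*} [AddCommGroup M] [Module (ZG G) M]
  [AddCommGroup N] [Module (ZG G) N] {X Y : Type*}
  (bM : Module.Basis X (ZG G) M) (bN : Module.Basis Y (ZG G) N)

/-! The chain equivalence is the comparison theorem made explicit. Maps defined on generators
through a contracting homotopy are chain maps (`d_compare`), and k, k' are homotopies from 1 to fg
and gf (`d_homotopyTo_succ`). These are identities of ZG-linear maps, so they pass to coinvariants,
where the cylinder of a homotopy equivalence reduces to both of its ends (`cylEquiv_isStrongEquiv`).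

Nilpotency: βα is locally nilpotent when αβ is (`LocallyNilpotent.comp_swap`), and f₁h₂g₁ = k'
(`cylEquiv_f_h_g`), so it suffices to treat ∂k' and δk'. Give [g₁|⋯|gₙ] the norm ‖g₁‖+⋯+‖gₙ‖. The
bar differential and h' do not raise norms. Compatibility bounds hₙ and dₙ₊₁ by opposite shifts, so
f shifts norms by at most -(i₀+⋯+iₙ₋₁) and g by at most the opposite amount; hence gf, and then k',
do not raise norms (`homotopyTo_bar_mem_normLE`). The last face deletes an entry gₙ ≠ 1 of positive
norm, so ∂k' and δk' strictly lower the norm of simplices.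

The new resolution: s contracts the twisted complex (`twRes_isFreeResolution`). Since f₁g₁ = 1, f₁h₁
= 0 and h₁g₁ = 0, the reduction ρ₁ survives the perturbation g₁δf₁ unchanged, so h₁ + g₁sf₁
contracts the perturbed cylinder. The perturbation lemma turns ρ₂ into chain maps F, G with FG = 1
(`IsPerturbation.map_d`, `IsPerturbation.d_map`, `IsPerturbation.map_map`), and conjugation by F and
G carries the contraction over to ZG ⊗ E (`isFreeResolution_of_perturbation`). -/

theorem aug_of (g : G) : aug G (MonoidAlgebra.of ℤ G g) = 1 := by
  simp [aug]

/-- The projection `M → ℤ ⊗_{ℤG} M = (X →₀ ℤ)` of a free `ℤG`-module with basis indexed by `X`. -/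
def augCoords : M →ₛₗ[(aug G : ZG G →+* ℤ)] (X →₀ ℤ) where
  toFun x := Finsupp.mapRange (aug G) (map_zero _) (bM.repr x)
  map_add' x y := by
    ext z
    simp
  map_smul' a x := by
    ext z
    simp

theorem augCoords_basis (x : X) : augCoords bM (bM x) = Finsupp.single x 1 := by
  simp [augCoords]

theorem coinv_single (φ : M →ₗ[ZG G] N) (x : X) :
    coinv bM bN φ (Finsupp.single x 1) = augCoords bN (φ (bM x)) := by
  simp [coinv, augCoords]

/-- Both sides are semilinear over `aug`, so the basis decides. With `augCoords_surjective` this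
transfers every identity between ZG-linear maps to coinvariants. -/
theorem coinv_augCoords (φ : M →ₗ[ZG G] N) (x : M) :
    coinv bM bN φ (augCoords bM x) = augCoords bN (φ x) := by
  have h : ∀ x, (⟨⟨fun x => coinv bM bN φ (augCoords bM x), by simp⟩, by simp⟩ :
      M →ₛₗ[(aug G : ZG G →+* ℤ)] (Y →₀ ℤ)) x = (augCoords bN).comp φ x := by
    refine fun x => DFunLike.congr_fun (bM.ext fun z => ?_) x
    change coinv bM bN φ (augCoords bM (bM z)) = augCoords bN (φ (bM z))
    rw [augCoords_basis, coinv_single]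
  exact h x

theorem augCoords_surjective : Function.Surjective (augCoords bM) := by
  intro y
  induction y using Finsupp.induction_linear with
  | zero => exact ⟨0, map_zero _⟩
  | add p q hp hq =>
    obtain ⟨x, rfl⟩ := hp
    obtain ⟨y, rfl⟩ := hq
    exact ⟨x + y, map_add _ _ _⟩
  | single z m =>
    refine ⟨m • bM z, ?_⟩
    rw [map_zsmul, augCoords_basis]
    simp

end Coinvariants

/-! ### Comparison maps and homotopies -/

section Comparison

variable {G : Type*} [Group G]
  {P : ℕ → Type*} [∀ n, AddCommGroup (P n)] [∀ n, Module (ZG G) (P n)]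
  {Z : ℕ → Type*} (b : ∀ n, Module.Basis (Z n) (ZG G) (P n))

theorem ResData.IsFreeResolution.ε_eq_of_basis {Q : ℕ → Type*} [∀ n, AddCommGroup (Q n)]
    [∀ n, Module (ZG G) (Q n)] {R : ResData G P} (hR : R.IsFreeResolution)
    {S : ResData G Q} (hS : S.IsFreeResolution) (φ : P 0 →ₗ[ZG G] Q 0)
    (h : ∀ z, S.ε (φ (b 0 z)) = R.ε (b 0 z)) (x : P 0) : S.ε (φ x) = R.ε x := by
  have key : (⟨⟨fun x => S.ε (φ x), by simp⟩, fun a x => by simp [hS.ε_smul]⟩ :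
      P 0 →ₛₗ[(aug G : ZG G →+* ℤ)] ℤ) =
      ⟨⟨fun x => R.ε x, by simp⟩, fun a x => by simp [hR.ε_smul]⟩ :=
    (b 0).ext h
  exact DFunLike.congr_fun key x

variable {Q : ℕ → Type*} [∀ n, AddCommGroup (Q n)] [∀ n, Module (ZG G) (Q n)]
  {R : ResData G P} {S : ResData G Q}

theorem ε_compare (hR : R.IsFreeResolution) (hS : S.IsFreeResolution) (x : P 0) :
    S.ε (compare b R S 0 x) = R.ε x :=
  hR.ε_eq_of_basis b hS _ (fun z => by simp [compare, hS.ε_hneg]) x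

/-- On a generator the map is h(w) with w = φdz, and dh(w) = w because w is a cycle: its boundary is
φddz = 0 by the previous degree, and in degree 0 its augmentation is εdz = 0. -/
theorem d_compare (hR : R.IsFreeResolution) (hS : S.IsFreeResolution) (n : ℕ) (x : P (n + 1)) :
    S.d n (compare b R S (n + 1) x) = compare b R S n (R.d n x) := by
  induction n with
  | zero =>
    refine DFunLike.congr_fun ((b 1).ext (f₁ := S.d 0 ∘ₗ compare b R S 1)
      (f₂ := compare b R S 0 ∘ₗ R.d 0) fun z => ?_) x
    have := hS.homotopy_zero (compare b R S 0 (R.d 0 (b 1 z)))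
    rw [ε_compare b hR hS, hR.ε_d, map_zero, zero_add] at this
    simpa [compare] using this
  | succ n ih =>
    refine DFunLike.congr_fun ((b (n + 2)).ext (f₁ := S.d (n + 1) ∘ₗ compare b R S (n + 2))
      (f₂ := compare b R S (n + 1) ∘ₗ R.d (n + 1)) fun z => ?_) x
    have := hS.homotopy_succ n (compare b R S (n + 1) (R.d (n + 1) (b (n + 2) z)))
    rw [ih, hR.d_d, map_zero, map_zero, zero_add] at this
    rw [LinearMap.comp_apply, LinearMap.comp_apply, compare, Module.Basis.constr_basis]
    exact this

theorem d_homotopyTo_zero (hR : R.IsFreeResolution) (ψ : ∀ n, P n →ₗ[ZG G] P n)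
    (hε : ∀ x, R.ε (ψ 0 x) = R.ε x) (x : P 0) :
    R.d 0 (homotopyTo b R ψ 0 x) = x - ψ 0 x := by
  refine DFunLike.congr_fun ((b 0).ext (f₁ := R.d 0 ∘ₗ homotopyTo b R ψ 0)
      (f₂ := LinearMap.id - ψ 0) fun z => ?_) x
  have := hR.homotopy_zero (b 0 z - ψ 0 (b 0 z))
  rw [map_sub, hε, sub_self, map_zero, zero_add] at this
  simpa [homotopyTo] using this

theorem d_homotopyTo_succ (hR : R.IsFreeResolution) (ψ : ∀ n, P n →ₗ[ZG G] P n)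
    (hε : ∀ x, R.ε (ψ 0 x) = R.ε x) (hψ : ∀ n x, R.d n (ψ (n + 1) x) = ψ n (R.d n x))
    (n : ℕ) (x : P (n + 1)) :
    R.d (n + 1) (homotopyTo b R ψ (n + 1) x) + homotopyTo b R ψ n (R.d n x) =
      x - ψ (n + 1) x := by
  -- The hypothesis is the identity of the previous degree at a boundary, where the term kdd drops
  -- out. It makes z - ψz - kdz a cycle.
  have key : ∀ n, (∀ x, R.d n (homotopyTo b R ψ n (R.d n x)) = R.d n x - ψ n (R.d n x)) →
      ∀ x, R.d (n + 1) (homotopyTo b R ψ (n + 1) x) + homotopyTo b R ψ n (R.d n x) =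
      x - ψ (n + 1) x := by
    intro n hn x
    refine DFunLike.congr_fun ((b (n + 1)).ext
      (f₁ := R.d (n + 1) ∘ₗ homotopyTo b R ψ (n + 1) + homotopyTo b R ψ n ∘ₗ R.d n)
      (f₂ := LinearMap.id - ψ (n + 1)) fun z => ?_) x
    have := hR.homotopy_succ n (b (n + 1) z - ψ (n + 1) (b (n + 1) z) -
      homotopyTo b R ψ n (R.d n (b (n + 1) z)))
    rw [map_sub (R.d n), map_sub (R.d n), hn, hψ, sub_self, map_zero, zero_add] at this
    rw [LinearMap.add_apply, LinearMap.comp_apply, LinearMap.comp_apply, homotopyTo,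
      Module.Basis.constr_basis, this]
    simp
  induction n with
  | zero => exact key 0 (fun x => d_homotopyTo_zero b hR ψ hε _) x
  | succ n ih =>
    refine key (n + 1) (fun x => ?_) x
    have := ih (R.d (n + 1) x)
    rwa [hR.d_d, map_zero, add_zero] at this

end Comparison

/-! ### Words, and resolutions recognized by their contraction -/

section Words

variable {G : Type*} [Group G] {M : Type*} [AddCommGroup M] [Module (ZG G) M] {X : Type*}
  (b : Module.Basis X (ZG G) M)

theorem smul_mem_of_words {A : AddSubgroup M} {x : M}
    (h : ∀ g, MonoidAlgebra.of ℤ G g • x ∈ A) (a : ZG G) : a • x ∈ A := by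
  induction a using MonoidAlgebra.induction_linear with
  | zero => simp [A.zero_mem]
  | add p q hp hq => rw [add_smul]; exact A.add_mem hp hq
  | single g m =>
    have : (MonoidAlgebra.single g m : ZG G) = m • MonoidAlgebra.of ℤ G g := by
      simp [MonoidAlgebra.of, MonoidAlgebra.smul_single]
    rw [this, smul_assoc]
    exact A.zsmul_mem (h g) m

theorem basis_induction {p : M → Prop} (x : M) (zero : p 0) (add : ∀ x y, p x → p y → p (x + y))
    (smul : ∀ (a : ZG G) z, p (a • b z)) : p x := by
  rw [← b.linearCombination_repr x]
  generalize b.repr x = y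
  induction y using Finsupp.induction_linear with
  | zero => simpa using zero
  | add y z hy hz => rw [map_add]; exact add _ _ hy hz
  | single z a => rw [Finsupp.linearCombination_single]; exact smul a z

theorem addSubgroup_eq_top_of_words (A : AddSubgroup M)
    (h : ∀ g z, MonoidAlgebra.of ℤ G g • b z ∈ A) : A = ⊤ := by
  rw [AddSubgroup.eq_top_iff']
  intro x
  induction x using basis_induction b with
  | zero => exact A.zero_mem
  | add p q hp hq => exact A.add_mem hp hq
  | smul a z => exact smul_mem_of_words (fun g => h g z) a

/-- Contracting homotopies are additive but not ZG-linear, so identities involving them are tested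
on all words gz and not just on the basis. -/
theorem addMonoidHom_ext_words {N : Type*} [AddCommGroup N] {φ ψ : M →+ N}
    (h : ∀ g z, φ (MonoidAlgebra.of ℤ G g • b z) = ψ (MonoidAlgebra.of ℤ G g • b z)) : φ = ψ := by
  have := addSubgroup_eq_top_of_words b (φ.eqLocus ψ) h
  ext x
  exact (this ▸ AddSubgroup.mem_top x : x ∈ φ.eqLocus ψ)

theorem wordsLift_single {N : Type*} [AddCommGroup N] (φ : G → X → N) (g : G) (x : X) :
    wordsLift φ (Finsupp.single x (MonoidAlgebra.of ℤ G g)) = φ g x := by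
  change ((Finsupp.liftAddHom fun x => (Finsupp.liftAddHom fun g => zmultiplesHom N (φ g x)).comp
    MonoidAlgebra.coeffAddEquiv.toAddMonoidHom) : (X →₀ ZG G) →+ N) _ = _
  rw [Finsupp.liftAddHom_apply_single]
  change Finsupp.liftAddHom _ (Finsupp.single g 1) = _
  rw [Finsupp.liftAddHom_apply_single]
  simp

theorem map_smul_of_words (φ : M →+ ℤ) (c : X → ℤ)
    (h : ∀ g z, φ (MonoidAlgebra.of ℤ G g • b z) = c z) (a : ZG G) (x : M) :
    φ (a • x) = aug G a * φ x := by
  have key : ∀ (a : ZG G) z, φ (a • b z) = aug G a * c z := by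
    intro a z
    induction a using MonoidAlgebra.induction_on with
    | of g => rw [h, aug_of, one_mul]
    | add p q hp hq => rw [add_smul, map_add, hp, hq, map_add, add_mul]
    | smul m p hp =>
      rw [smul_assoc, map_zsmul, hp, map_zsmul, smul_mul_assoc]
  induction x using basis_induction b with
  | zero => simp
  | add p q hp hq => rw [smul_add, map_add, map_add, hp, hq, mul_add]
  | smul a' z => rw [smul_smul, key, key, map_mul, mul_assoc]

/-- A graded free module with a contracting homotopy is a resolution if the generators in positive
degrees are values of the homotopy. -/
theorem isFreeResolution_of_homotopy {G : Type*} [Group G] {Q : ℕ → Type*}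
    [∀ n, AddCommGroup (Q n)] [∀ n, Module (ZG G) (Q n)] {Z : ℕ → Type*}
    (b : ∀ n, Module.Basis (Z n) (ZG G) (Q n)) {S : ResData G Q}
    (ε_smul : ∀ (a : ZG G) (x : Q 0), S.ε (a • x) = aug G a * S.ε x)
    (ε_hneg : ∀ m, S.ε (S.hneg m) = m)
    (homotopy_zero : ∀ x, S.hneg (S.ε x) + S.d 0 (S.h 0 x) = x)
    (homotopy_succ : ∀ n x, S.h n (S.d n x) + S.d (n + 1) (S.h (n + 1) x) = x)
    (hb : ∀ n z, ∃ y, b (n + 1) z = S.h n y) : S.IsFreeResolution := by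
  have ε_d : ∀ x, S.ε (S.d 0 x) = 0 := by
    intro x
    induction x using basis_induction (b 1) with
    | zero => simp
    | add p q hp hq => rw [map_add, map_add, hp, hq, add_zero]
    | smul a z =>
      obtain ⟨y, hy⟩ := hb 0 z
      rw [map_smul, ε_smul, hy]
      have := congrArg S.ε (homotopy_zero y)
      rw [map_add, ε_hneg] at this
      rw [add_eq_left.mp this, mul_zero]
  refine ⟨fun n => Module.Free.of_basis (b n), ε_smul, ε_d, fun n => ?_, ε_hneg, homotopy_zero,
    homotopy_succ⟩
  -- Applying d to hdy + dhy = y leaves ddhy = 0 once dhd = d is known, and dhd = d follows from the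
  -- vanishing one degree lower. By linearity, it is enough to treat the generators hy.
  have key : ∀ n, (∀ y, S.d n (S.h n (S.d n y)) = S.d n y) → ∀ x, S.d n (S.d (n + 1) x) = 0 := by
    intro n hn x
    refine DFunLike.congr_fun ((b (n + 2)).ext (f₁ := S.d n ∘ₗ S.d (n + 1)) (f₂ := 0)
      fun z => ?_) x
    obtain ⟨y, hy⟩ := hb (n + 1) z
    have h1 := congrArg (S.d n) (homotopy_succ n y)
    rw [map_add, hn] at h1
    rw [hy]
    exact add_eq_left.mp h1
  induction n with
  | zero =>
    refine key 0 fun y => ?_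
    have := homotopy_zero (S.d 0 y)
    rwa [ε_d, map_zero, zero_add] at this
  | succ n ih =>
    refine key (n + 1) fun y => ?_
    have := homotopy_succ n (S.d (n + 1) y)
    rwa [ih, map_zero, zero_add] at this

end Words

/-! ### Faces of a simplex with an entry put in front -/

section Faces

variable {G : Type*} [Group G]

theorem face_zero {n : ℕ} (x : Fin (n + 1) → G) : face 0 x = fun j => x j.succ := rfl

theorem face_succ {n : ℕ} (j : Fin (n + 1)) (x : Fin (n + 1) → G) :
    face j.succ x = Fin.contractNth j (· * ·) x := rfl

theorem face_zero_cons {n : ℕ} (g : G) (x : Fin n → G) :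
    face 0 (Fin.cons g x : Fin (n + 1) → G) = x := by
  ext j; simp [face_zero]

theorem face_one_cons {n : ℕ} (g : G) (x : Fin (n + 1) → G) :
    face (0 : Fin (n + 2)).succ (Fin.cons g x : Fin (n + 2) → G) =
      Fin.cons (g * x 0) (face 0 x) := by
  rw [face_succ]
  ext k
  cases k using Fin.cases with
  | zero => simp [Fin.contractNth]
  | succ k => simp [Fin.contractNth, face_zero]

theorem face_succ_succ_cons {n : ℕ} (j : Fin (n + 1)) (g : G) (x : Fin (n + 1) → G) :
    face j.succ.succ (Fin.cons g x : Fin (n + 2) → G) = Fin.cons g (face j.succ x) := by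
  rw [face_succ, face_succ]
  ext k
  cases k using Fin.cases with
  | zero => simp [Fin.contractNth]
  | succ k => simp [Fin.contractNth]

theorem face_succ_last {n : ℕ} (x : Fin (n + 1) → G) :
    face (Fin.last (n + 1)) x = Fin.init x := by
  rw [← Fin.succ_last, face_succ]
  ext k
  simp [Fin.contractNth, Fin.init]

end Faces

/-! ### The normalized bar resolution -/

section BarResolution

variable {G : Type*} [Group G]

theorem barElt_of_ne {n : ℕ} (a : ZG G) {x : Fin n → G} (hx : ∀ i, x i ≠ 1) :
    barElt a x = Finsupp.single ⟨x, hx⟩ a := dif_pos hx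

theorem barElt_of_eq {n : ℕ} (a : ZG G) {x : Fin n → G} {i : Fin n} (hx : x i = 1) :
    barElt a x = 0 := dif_neg fun h => h i hx

theorem smul_barElt {n : ℕ} (a c : ZG G) (x : Fin n → G) :
    a • barElt c x = barElt (a * c) x := by
  unfold barElt
  split_ifs <;> simp

theorem barElt_eq_smul_basis {n : ℕ} (a : ZG G) (x : Simp G n) :
    barElt a x.1 = a • barBasis G n x := by
  rw [barElt_of_ne a x.2]
  simp [barBasis]

theorem barBasis_apply {n : ℕ} (x : Simp G n) : barBasis G n x = barElt 1 x.1 := by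
  rw [barElt_eq_smul_basis, one_smul]

/-- This also covers degenerate x, since an entry 1 stays an entry 1; the faces in a boundary can
then be treated without case distinctions. -/
theorem barRes_h {n : ℕ} (g : G) (x : Fin n → G) :
    (barRes G).h n (barElt (MonoidAlgebra.of ℤ G g) x) = barElt 1 (Fin.cons g x) := by
  by_cases hx : ∀ i, x i ≠ 1
  · rw [barElt_of_ne _ hx]
    exact wordsLift_single _ _ _
  · push Not at hx
    obtain ⟨i, hi⟩ := hx
    rw [barElt_of_eq _ hi, map_zero, barElt_of_eq (i := i.succ) _ (by simpa using hi)]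

theorem barRes_ε (g : G) (x : Fin 0 → G) :
    (barRes G).ε (barElt (MonoidAlgebra.of ℤ G g) x) = 1 := by
  rw [barElt_of_ne _ (fun i => i.elim0)]
  exact wordsLift_single _ _ _

theorem barDiff_barElt {n : ℕ} (a : ZG G) {x : Fin (n + 1) → G} (hx : ∀ i, x i ≠ 1) :
    barDiff G n (barElt a x) = a • (barElt (MonoidAlgebra.of ℤ G (x 0)) (face 0 x) +
      ∑ j : Fin (n + 1), (-1 : ℤ) ^ ((j : ℕ) + 1) • barElt 1 (face j.succ x)) := by
  rw [barElt_of_ne _ hx, barDiff, Finsupp.linearCombination_single]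

theorem barRes_homotopy_zero (y : Bar G 0) :
    (barRes G).hneg ((barRes G).ε y) + (barRes G).d 0 ((barRes G).h 0 y) = y := by
  refine DFunLike.congr_fun (addMonoidHom_ext_words (barBasis G 0)
    (φ := (barRes G).hneg.comp (barRes G).ε +
      ((barRes G).d 0).toAddMonoidHom.comp ((barRes G).h 0))
    (ψ := AddMonoidHom.id _) fun g x => ?_) y
  change (barRes G).hneg ((barRes G).ε _) + barDiff G 0 ((barRes G).h 0 _) = _
  rw [← barElt_eq_smul_basis, barRes_ε, barRes_h]
  have h0 : ∀ y : Fin 0 → G, y = x.1 := fun y => Subsingleton.elim _ _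
  have h1 : (barRes G).hneg 1 = barElt 1 x.1 := by
    simp [barRes, h0 Fin.elim0]
  rw [h1]
  by_cases hg : g = 1
  · subst hg
    rw [barElt_of_eq (i := 0) (x := Fin.cons 1 x.1) _ (by simp), map_zero, map_one, add_zero]
    rfl
  · rw [barDiff_barElt _ (by intro i; rw [Fin.fin_one_eq_zero i]; simpa using hg)]
    simp [h0 (face _ _)]

theorem barRes_homotopy_succ (n : ℕ) (y : Bar G (n + 1)) :
    (barRes G).h n ((barRes G).d n y) + (barRes G).d (n + 1) ((barRes G).h (n + 1) y) = y := by
  refine DFunLike.congr_fun (addMonoidHom_ext_words (barBasis G (n + 1))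
    (φ := ((barRes G).h n).comp ((barRes G).d n).toAddMonoidHom +
      ((barRes G).d (n + 1)).toAddMonoidHom.comp ((barRes G).h (n + 1)))
    (ψ := AddMonoidHom.id _) fun g x => ?_) y
  change (barRes G).h n (barDiff G n _) + barDiff G (n + 1) ((barRes G).h (n + 1) _) = _
  rw [← barElt_eq_smul_basis, barRes_h, barDiff_barElt _ x.2]
  simp only [smul_add, Finset.smul_sum, map_add, map_sum, smul_comm _ ((-1 : ℤ) ^ _), map_zsmul,
    smul_barElt, mul_one, barRes_h, ← map_mul]
  -- For g = 1 the simplex [1|x] is zero, and in h'd only the term from the face ∂₀ survives,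
  -- because its coefficient is the first entry of x. Otherwise all terms cancel in pairs except x
  -- itself.
  by_cases hg : g = 1
  · subst hg
    have h0 : ∀ z : Fin n → G, barElt (1 : ZG G) (Fin.cons 1 z : Fin (n + 1) → G) = 0 :=
      fun z => barElt_of_eq (i := 0) _ (by simp)
    rw [barElt_of_eq (i := 0) (x := Fin.cons 1 x.1) _ (by simp)]
    simp only [h0, smul_zero, Finset.sum_const_zero, map_zero, add_zero, one_mul, map_one]
    congr 1
    ext i
    cases i using Fin.cases <;> simp [face_zero]
  · rw [barDiff_barElt _ (by intro i; cases i using Fin.cases <;> simp [hg, x.2]),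
      Fin.sum_univ_succ (n := n + 1)]
    simp only [one_smul, face_zero_cons, face_one_cons, face_succ_succ_cons, Fin.cons_zero,
      Fin.val_succ, pow_succ (-1 : ℤ) (_ + 1), mul_neg, mul_one, neg_smul, Finset.sum_neg_distrib]
    simp
    abel

theorem barRes_ε_smul (a : ZG G) (x : Bar G 0) :
    (barRes G).ε (a • x) = aug G a * (barRes G).ε x := by
  refine map_smul_of_words (barBasis G 0) _ 1 (fun g z => ?_) a x
  rw [← barElt_eq_smul_basis, barRes_ε]
  rfl

theorem barRes_ε_hneg (m : ℤ) : (barRes G).ε ((barRes G).hneg m) = m := by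
  have : (barRes G).hneg m = m • barElt (MonoidAlgebra.of ℤ G 1) Fin.elim0 := by
    rw [map_one]
    simp [barRes]
  rw [this, map_zsmul, barRes_ε, smul_eq_mul, mul_one]

/-- Since [x₀|x₁|⋯] = h'(x₀[x₁|⋯]), the relation dd = 0 comes from the contraction and no simplicial
identities are needed. -/
theorem barRes_isFreeResolution : (barRes G).IsFreeResolution :=
  isFreeResolution_of_homotopy (barBasis G) barRes_ε_smul barRes_ε_hneg barRes_homotopy_zero
    barRes_homotopy_succ fun n x => ⟨barElt (MonoidAlgebra.of ℤ G (x.1 0)) (Fin.tail x.1), by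
      rw [barRes_h, Fin.cons_self_tail, barBasis_apply]⟩

theorem augCoords_barElt {n : ℕ} (a : ZG G) (x : Fin n → G) :
    augCoords (barBasis G n) (barElt a x) = aug G a • nchain x := by
  by_cases hx : ∀ i, x i ≠ 1
  · lift x to Simp G n using hx
    rw [barElt_eq_smul_basis, map_smulₛₗ, augCoords_basis, nchain, dif_pos x.2]
    rfl
  · rw [nchain, dif_neg hx, barElt, dif_neg hx]
    simp

/-- The two differentials differ in the coefficient g₁ of ∂₀, which augments to 1. -/
theorem chainDiff_eq_coinv (n : ℕ) :
    chainDiff G n = coinv (barBasis G (n + 1)) (barBasis G n) (barDiff G n) := by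
  refine Finsupp.lhom_ext' fun x => LinearMap.ext_ring ?_
  change chainDiff G n (Finsupp.single x 1) = coinv _ _ _ (Finsupp.single x 1)
  rw [coinv_single, barBasis_apply, barDiff_barElt _ x.2, one_smul, map_add, map_sum, chainDiff,
    Fin.sum_univ_succ]
  simp only [map_zsmul, augCoords_barElt, aug_of, map_one, one_smul]
  simp [faceMap]

end BarResolution

/-! ### The mapping cylinder and its two reductions -/

section CylinderElements

variable {C : ℕ → Type u} {E : ℕ → Type v}

theorem Cyl.forall_zero {p : Cyl C E 0 → Prop} : (∀ x, p x) ↔ ∀ c s e, p (c, s, e) :=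
  ⟨fun h _ _ _ => h _, fun h ⟨c, s, e⟩ => h c s e⟩

variable [∀ n, AddCommGroup (C n)]

theorem Cyl.forall_succ {n : ℕ} {p : Cyl C E (n + 1) → Prop} :
    (∀ x, p x) ↔ ∀ c (s : C n) e, p (c, (Shift.unshift n).symm s, e) :=
  ⟨fun h _ _ _ => h _, fun h ⟨c, s, e⟩ => h c s e⟩

end CylinderElements

section AbstractReduction

variable {C : ℕ → Type*} {D : ℕ → Type*} [∀ n, AddCommGroup (C n)] [∀ n, AddCommGroup (D n)]

/-- A homotopy `η` from `1` to `g f` with `f η = 0` and `η g = 0` becomes the homotopy of a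
reduction when it is replaced by `η d η`. -/
theorem isReduction_of_homotopy (ρ : RedData C D) {dC : ∀ n, C (n + 1) →ₗ[ℤ] C n}
    {dD : ∀ n, D (n + 1) →ₗ[ℤ] D n} (η : ∀ n, C n →ₗ[ℤ] C (n + 1))
    (hh : ∀ n x, ρ.h n x = η n (dC n (η n x)))
    (f_d : ∀ n x, ρ.f n (dC n x) = dD n (ρ.f (n + 1) x))
    (g_d : ∀ n y, ρ.g n (dD n y) = dC n (ρ.g (n + 1) y))
    (f_g : ∀ n y, ρ.f n (ρ.g n y) = y)
    (hzero : ∀ x, dC 0 (η 0 x) = x - ρ.g 0 (ρ.f 0 x))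
    (hsucc : ∀ n x, dC (n + 1) (η (n + 1) x) + η n (dC n x) = x - ρ.g (n + 1) (ρ.f (n + 1) x))
    (f_η : ∀ n x, ρ.f (n + 1) (η n x) = 0)
    (η_g : ∀ n y, η n (ρ.g n y) = 0)
    (d_d : IsDifferential dC) : ρ.IsReduction dC dD := by
  -- The side conditions make ηd and dη idempotent, so ηdη satisfies the same homotopy identity as
  -- η. Its square vanishes because dηη = η - ηdη and ηdηd = ηd.
  have hη : ∀ n x, η n (dC n (η n (dC n x))) = η n (dC n x) := by
    intro n x
    cases n with
    | zero => rw [hzero, map_sub, η_g, sub_zero]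
    | succ n =>
      have := hsucc n (dC (n + 1) x)
      rw [d_d, map_zero, add_zero] at this
      rw [this, map_sub, η_g, sub_zero]
  have hd : ∀ n x, dC n (η n (dC n (η n x))) = dC n (η n x) := by
    intro n x
    cases n with
    | zero => rw [hzero (dC 0 _), f_d, f_η, map_zero, map_zero, sub_zero]
    | succ n =>
      have := hsucc n (dC (n + 1) (η (n + 1) x))
      rw [d_d, map_zero, add_zero] at this
      rw [this, f_d, f_η, map_zero, map_zero, sub_zero]
  have hηη : ∀ n x, dC (n + 1) (η (n + 1) (η n x)) = η n x - η n (dC n (η n x)) := by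
    intro n x
    have := hsucc n (η n x)
    rw [f_η, map_zero, sub_zero] at this
    exact eq_sub_of_add_eq this
  exact
  { f_d := f_d
    g_d := g_d
    f_g := f_g
    homotopy_zero := fun x => by rw [hh, hd, hzero]
    homotopy_succ := fun n x => by rw [hh, hh, hd, hη, hsucc]
    f_h := fun n x => by rw [hh, f_η]
    h_g := fun n y => by rw [hh, η_g, map_zero, map_zero]
    h_h := fun n x => by rw [hh n, hh, hηη, hη, sub_self, map_zero] }

end AbstractReduction

section Cylinder

variable {C : ℕ → Type u} {E : ℕ → Type v} [∀ n, AddCommGroup (C n)] [∀ n, AddCommGroup (E n)]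
  (dC : ∀ n, C (n + 1) →ₗ[ℤ] C n) (dE : ∀ n, E (n + 1) →ₗ[ℤ] E n)
  (f : ∀ n, C n →ₗ[ℤ] E n) (g : ∀ n, E n →ₗ[ℤ] C n)
  (k : ∀ n, E n →ₗ[ℤ] E (n + 1)) (k' : ∀ n, C n →ₗ[ℤ] C (n + 1))

theorem cylDiff_apply (n : ℕ) (c : C (n + 1)) (s : C n) (e : E (n + 1)) :
    cylDiff dC dE f n (c, (Shift.unshift n).symm s, e) =
      (dC n c + s, -Shift.diff dC n s, dE n e - f n s) := rfl

theorem cylHomotopy_zero (c : C 0) (s : Shift C 0) (e : E 0) :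
    cylHomotopy f g k k' 0 (c, s, e) =
      (k' 0 (g 0 e) - g 1 (k 0 e - (k 0 (f 0 (g 0 e)) - f 1 (k' 0 (g 0 e)))),
        (Shift.unshift 0).symm (-g 0 e),
        k 0 e - (k 0 (f 0 (g 0 e)) - f 1 (k' 0 (g 0 e)))) := by
  simp [cylHomotopy, Shift.desc, Cyl.p₂, Cyl.p₃]

theorem cylHomotopy_succ (n : ℕ) (c : C (n + 1)) (s : C n) (e : E (n + 1)) :
    cylHomotopy f g k k' (n + 1) (c, (Shift.unshift n).symm s, e) =
      (k' (n + 1) (k' n s + g (n + 1) e) - g (n + 2) (k (n + 1) e -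
          (k (n + 1) (f (n + 1) (k' n s + g (n + 1) e)) -
            f (n + 2) (k' (n + 1) (k' n s + g (n + 1) e)))),
        (Shift.unshift (n + 1)).symm (-(k' n s + g (n + 1) e)),
        k (n + 1) e - (k (n + 1) (f (n + 1) (k' n s + g (n + 1) e)) -
            f (n + 2) (k' (n + 1) (k' n s + g (n + 1) e)))) := rfl

theorem cylLeft_f_zero (c : C 0) (s : Shift C 0) (e : E 0) :
    (cylLeft dC dE f g k k').f 0 (c, s, e) = c + g 0 e := by
  simp [cylLeft, Shift.desc, Cyl.p₁, Cyl.p₃]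

theorem cylLeft_f_succ (n : ℕ) (c : C (n + 1)) (s : C n) (e : E (n + 1)) :
    (cylLeft dC dE f g k k').f (n + 1) (c, (Shift.unshift n).symm s, e) =
      c + k' n s + g (n + 1) e := rfl

theorem cylLeft_g (n : ℕ) (c : C n) : (cylLeft dC dE f g k k').g n c = (c, 0, 0) := rfl

theorem cylRight_f (n : ℕ) (c : C n) (s : Shift C n) (e : E n) :
    (cylRight f).f n (c, s, e) = f n c + e := rfl

theorem cylRight_g (n : ℕ) (e : E n) : (cylRight f).g n e = (0, 0, e) := rfl

theorem cylRight_h (n : ℕ) (c : C n) (s : Shift C n) (e : E n) :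
    (cylRight f).h n (c, s, e) = (0, (Shift.unshift n).symm c, 0) := rfl

theorem Shift.diff_zero (s : C 0) : Shift.diff dC 0 s = 0 := rfl

theorem Shift.diff_succ (n : ℕ) (s : C (n + 1)) :
    Shift.diff dC (n + 1) s = (Shift.unshift n).symm (dC n s) := rfl

theorem Shift.eq_zero (s : Shift C 0) : s = 0 := rfl

variable {dC dE f g k k'}

theorem cylDiff_isDifferential (hC : IsDifferential dC) (hE : IsDifferential dE)
    (hf : ∀ n x, dE n (f (n + 1) x) = f n (dC n x)) : IsDifferential (cylDiff dC dE f) := by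
  intro n
  rw [Cyl.forall_succ]
  intro c s e
  rw [cylDiff_apply, Shift.diff_succ, ← map_neg, cylDiff_apply]
  simp only [map_add, map_sub, map_neg, hC n, hE n, hf, sub_neg_eq_add]
  have : Shift.diff dC n (dC n s) = 0 := by
    cases n with
    | zero => rfl
    | succ n => rw [Shift.diff_succ, hC, map_zero]
  rw [this]
  simp

/-- The cylinder of any chain map contracts onto its target; only the reduction to the source needs
a homotopy inverse. -/
theorem cylRight_isReduction (hf : ∀ n x, dE n (f (n + 1) x) = f n (dC n x)) :
    (cylRight f).IsReduction (cylDiff dC dE f) dE where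
  f_d n := by
    rw [Cyl.forall_succ]
    intro c s e
    rw [cylDiff_apply, cylRight_f, cylRight_f, map_add, map_add, hf]
    abel
  g_d n e := by
    rw [cylRight_g, cylRight_g, ← map_zero (Shift.unshift n).symm, cylDiff_apply]
    simp
  f_g n e := by simp [cylRight_f, cylRight_g]
  homotopy_zero := by
    rw [Cyl.forall_zero]
    intro c s e
    rw [cylRight_h, cylDiff_apply, cylRight_f, cylRight_g, Shift.eq_zero s, Shift.diff_zero]
    simp
  homotopy_succ n := by
    rw [Cyl.forall_succ]
    intro c s e
    rw [cylRight_h, cylDiff_apply, cylDiff_apply, cylRight_h, cylRight_f, cylRight_g,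
      Shift.diff_succ]
    simp
  f_h n := by
    rintro ⟨c, s, e⟩
    rw [cylRight_h, cylRight_f, map_zero, add_zero]
  h_g n e := by rw [cylRight_g, cylRight_h, map_zero]; rfl
  h_h n := by
    rintro ⟨c, s, e⟩
    rw [cylRight_h, cylRight_h, map_zero]; rfl

/-- The form of η gives f₁η = 0, and ηg₁ = 0 because η ignores c. Since kf and fk' may differ, v
needs its correction -θy with θ = kf - fk'. This θ anticommutes with d, and dy minus the y of
d(c,c',e) is c', so the correction replaces -kfc' by -fk'c' in the third coordinate of dη + ηd.
Together with fy this leaves e. -/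
theorem cylLeft_isReduction (hC : IsDifferential dC) (hE : IsDifferential dE)
    (hf : ∀ n x, dE n (f (n + 1) x) = f n (dC n x))
    (hg : ∀ n x, dC n (g (n + 1) x) = g n (dE n x))
    (hk_zero : ∀ x, dE 0 (k 0 x) = x - f 0 (g 0 x))
    (hk_succ : ∀ n x, dE (n + 1) (k (n + 1) x) + k n (dE n x) = x - f (n + 1) (g (n + 1) x))
    (hk'_zero : ∀ x, dC 0 (k' 0 x) = x - g 0 (f 0 x))
    (hk'_succ : ∀ n x, dC (n + 1) (k' (n + 1) x) + k' n (dC n x) = x - g (n + 1) (f (n + 1) x)) :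
    (cylLeft dC dE f g k k').IsReduction (cylDiff dC dE f) dC := by
  have hk : ∀ n x, dE (n + 1) (k (n + 1) x) = x - f (n + 1) (g (n + 1) x) - k n (dE n x) :=
    fun n x => eq_sub_of_add_eq (hk_succ n x)
  have hk' : ∀ n x, dC (n + 1) (k' (n + 1) x) = x - g (n + 1) (f (n + 1) x) - k' n (dC n x) :=
    fun n x => eq_sub_of_add_eq (hk'_succ n x)
  refine isReduction_of_homotopy _ (cylHomotopy f g k k') (fun _ _ => rfl) ?_ ?_ ?_ ?_ ?_ ?_ ?_
    (cylDiff_isDifferential hC hE hf)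
  · intro n
    rw [Cyl.forall_succ]
    intro c s e
    cases n with
    | zero =>
      rw [cylDiff_apply, cylLeft_f_zero, cylLeft_f_succ]
      simp only [map_add, map_sub, hg, hk'_zero]
      abel
    | succ n =>
      rw [cylDiff_apply, Shift.diff_succ, ← map_neg, cylLeft_f_succ, cylLeft_f_succ]
      simp only [map_add, map_sub, map_neg, hg, hk']
      abel
  · intro n c
    rw [cylLeft_g, cylLeft_g, ← map_zero (Shift.unshift n).symm, cylDiff_apply]
    simp
  · intro n c
    cases n with
    | zero => rw [cylLeft_g, cylLeft_f_zero, map_zero, add_zero]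
    | succ n =>
      rw [cylLeft_g, ← map_zero (Shift.unshift n).symm, cylLeft_f_succ]
      simp
  · rw [Cyl.forall_zero]
    intro c s e
    rw [cylHomotopy_zero, cylDiff_apply, cylLeft_f_zero, cylLeft_g, Shift.eq_zero s,
      Shift.diff_zero]
    simp only [map_sub, map_neg, hf, hg, hk_zero, hk'_zero]
    refine Prod.ext ?_ (Prod.ext ?_ ?_)
    · simp only [Prod.mk_sub_mk]
      abel
    · simp
    · simp only [Prod.mk_sub_mk]
      abel
  · intro n
    rw [Cyl.forall_succ]
    intro c s e
    rw [cylHomotopy_succ, cylDiff_apply, cylDiff_apply, cylLeft_f_succ, cylLeft_g,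
      Shift.diff_succ]
    cases n with
    | zero =>
      rw [Shift.diff_zero, cylHomotopy_zero]
      refine Prod.ext ?_ (Prod.ext ?_ ?_)
      · simp only [Prod.mk_sub_mk, Prod.mk_add_mk]
        simp only [map_add, map_sub, hf, hg, hk, hk', hk'_zero]
        abel
      · simp only [Prod.mk_sub_mk, Prod.mk_add_mk]
        simp only [← map_neg, ← map_add, sub_zero]
        congr 1
        simp only [map_add, map_sub, map_neg, hg, hk'_zero]
        abel
      · simp only [Prod.mk_sub_mk, Prod.mk_add_mk]
        simp only [map_add, map_sub, map_neg, hf, hg, hk, hk', hk'_zero]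
        abel
    | succ n =>
      rw [Shift.diff_succ, ← map_neg (Shift.unshift n).symm, cylHomotopy_succ]
      refine Prod.ext ?_ (Prod.ext ?_ ?_)
      · simp only [Prod.mk_sub_mk, Prod.mk_add_mk]
        simp only [map_add, map_sub, map_neg, hf, hg, hk, hk']
        abel
      · simp only [Prod.mk_sub_mk, Prod.mk_add_mk]
        simp only [← map_neg, ← map_add, sub_zero]
        congr 1
        simp only [map_add, map_sub, map_neg, hg, hk']
        abel
      · simp only [Prod.mk_sub_mk, Prod.mk_add_mk]
        simp only [map_add, map_sub, map_neg, hf, hg, hk, hk']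
        abel
  · intro n
    cases n with
    | zero =>
      rw [Cyl.forall_zero]
      intro c s e
      rw [cylHomotopy_zero, cylLeft_f_succ, map_neg]
      abel
    | succ n =>
      rw [Cyl.forall_succ]
      intro c s e
      rw [cylHomotopy_succ, cylLeft_f_succ, map_neg]
      abel
  · intro n c
    cases n with
    | zero =>
      rw [cylLeft_g, cylHomotopy_zero]
      simp
    | succ n =>
      rw [cylLeft_g, ← map_zero (Shift.unshift n).symm, cylHomotopy_succ]
      simp

theorem cylEquiv_isStrongEquiv (hC : IsDifferential dC) (hE : IsDifferential dE)
    (hf : ∀ n x, dE n (f (n + 1) x) = f n (dC n x))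
    (hg : ∀ n x, dC n (g (n + 1) x) = g n (dE n x))
    (hk_zero : ∀ x, dE 0 (k 0 x) = x - f 0 (g 0 x))
    (hk_succ : ∀ n x, dE (n + 1) (k (n + 1) x) + k n (dE n x) = x - f (n + 1) (g (n + 1) x))
    (hk'_zero : ∀ x, dC 0 (k' 0 x) = x - g 0 (f 0 x))
    (hk'_succ : ∀ n x, dC (n + 1) (k' (n + 1) x) + k' n (dC n x) = x - g (n + 1) (f (n + 1) x)) :
    (cylEquiv dC dE f g k k').IsStrongEquiv dC dE where
  dC_isDifferential := hC
  dD_isDifferential := cylDiff_isDifferential hC hE hf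
  dE_isDifferential := hE
  ρ₁_isReduction := cylLeft_isReduction hC hE hf hg hk_zero hk_succ hk'_zero hk'_succ
  ρ₂_isReduction := cylRight_isReduction hf

end Cylinder

/-! ### The strong equivalence on coinvariants -/

section EffectiveHomology

variable {G : Type u} [Group G]
  {P : ℕ → Type v} [∀ n, AddCommGroup (P n)] [∀ n, Module (ZG G) (P n)]
  {Z : ℕ → Type w} (b : ∀ n, Module.Basis (Z n) (ZG G) (P n)) {R : ResData G P}

theorem effHom_isStrongEquiv (hR : R.IsFreeResolution) :
    (effHom b R).IsStrongEquiv (chainDiff G) (coinvDiff b R) := by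
  have hB : (barRes G).IsFreeResolution := barRes_isFreeResolution
  have hfε := ε_compare (barBasis G) hB hR
  have hgε := ε_compare b hR hB
  have hfd := d_compare (barBasis G) hB hR
  have hgd := d_compare b hR hB
  have hC : chainDiff G = fun n => coinv (barBasis G (n + 1)) (barBasis G n) (barDiff G n) :=
    funext chainDiff_eq_coinv
  unfold effHom
  rw [hC]
  refine cylEquiv_isStrongEquiv ?_ ?_ ?_ ?_ ?_ ?_ ?_ ?_
  · intro n x
    obtain ⟨x, rfl⟩ := augCoords_surjective (barBasis G (n + 2)) x
    simp only [coinv_augCoords]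
    exact (congrArg _ (hB.d_d n x)).trans (map_zero _)
  · intro n x
    obtain ⟨x, rfl⟩ := augCoords_surjective (b (n + 2)) x
    simp only [coinvDiff, coinv_augCoords, hR.d_d, map_zero]
  · intro n x
    obtain ⟨x, rfl⟩ := augCoords_surjective (barBasis G (n + 1)) x
    simp only [coinvDiff, coinv_augCoords, hfd]
    rfl
  · intro n x
    obtain ⟨x, rfl⟩ := augCoords_surjective (b (n + 1)) x
    simp only [coinvDiff, coinv_augCoords, ← hgd]
    rfl
  · intro x
    obtain ⟨x, rfl⟩ := augCoords_surjective (b 0) x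
    simp only [coinvDiff, coinv_augCoords]
    rw [d_homotopyTo_zero b hR _ (fun x => by simp [hfε, hgε]), map_sub]
    rfl
  · intro n x
    obtain ⟨x, rfl⟩ := augCoords_surjective (b (n + 1)) x
    simp only [coinvDiff, coinv_augCoords, ← map_add]
    rw [d_homotopyTo_succ b hR _ (fun x => by simp [hfε, hgε]) (fun n x => by simp [hfd, hgd]),
      map_sub]
    rfl
  · intro x
    obtain ⟨x, rfl⟩ := augCoords_surjective (barBasis G 0) x
    simp only [coinv_augCoords]
    refine (congrArg (augCoords (barBasis G 0)) (d_homotopyTo_zero (barBasis G) hB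
      (fun n => compare b R (barRes G) n ∘ₗ compare (barBasis G) (barRes G) R n)
      (fun x => by simp [hfε, hgε]) x)).trans ?_
    rw [map_sub]
    rfl
  · intro n x
    obtain ⟨x, rfl⟩ := augCoords_surjective (barBasis G (n + 1)) x
    simp only [coinv_augCoords, ← map_add]
    refine (congrArg (augCoords (barBasis G (n + 1))) (d_homotopyTo_succ (barBasis G) hB
      (fun n => compare b R (barRes G) n ∘ₗ compare (barBasis G) (barRes G) R n)
      (fun x => by simp [hfε, hgε]) (fun n x => by simp [hfd, hgd]) n x)).trans ?_
    rw [map_sub]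
    rfl

end EffectiveHomology

/-! ### The norm filtration of a free module -/

section Filtration

variable {G : Type*} [Group G] {M N : Type*} [AddCommGroup M] [Module (ZG G) M]
  [AddCommGroup N] [Module (ZG G) N] {X Y : Type*}
  (bM : Module.Basis X (ZG G) M) (bN : Module.Basis Y (ZG G) N)
  (ℓ : G → ℕ) (μ : X → ℕ) (ν : Y → ℕ)

/-- The elements of a free `ℤG`-module all of whose words have norm at most `m`. -/
def normLE (m : ℤ) : AddSubgroup M :=
  AddSubgroup.closure {x | ∃ g z, (ℓ g + μ z : ℤ) ≤ m ∧ x = MonoidAlgebra.of ℤ G g • bM z}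

variable {ℓ μ ν}

theorem word_mem_normLE {g : G} {z : X} {m : ℤ} (h : (ℓ g + μ z : ℤ) ≤ m) :
    MonoidAlgebra.of ℤ G g • bM z ∈ normLE bM ℓ μ m :=
  AddSubgroup.subset_closure ⟨g, z, h, rfl⟩

variable {bM} in
theorem normLE_mono {m m' : ℤ} (h : m ≤ m') : normLE bM ℓ μ m ≤ normLE bM ℓ μ m' :=
  AddSubgroup.closure_mono fun _ ⟨g, z, hm, hx⟩ => ⟨g, z, hm.trans h, hx⟩

variable {bM} in
theorem mem_normLE_of_words {x : M} {m : ℤ}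
    (h : ∀ z g, (bM.repr x z).coeff g ≠ 0 → (ℓ g + μ z : ℤ) ≤ m) : x ∈ normLE bM ℓ μ m := by
  rw [← bM.linearCombination_repr x, Finsupp.linearCombination_apply]
  refine AddSubgroup.sum_mem _ fun z _ => ?_
  dsimp only
  rw [← MonoidAlgebra.sum_coeff_single (bM.repr x z), Finsupp.sum, Finset.sum_smul]
  refine AddSubgroup.sum_mem _ fun g hg => ?_
  have : ∀ c : ℤ, (MonoidAlgebra.single g c : ZG G) = c • MonoidAlgebra.of ℤ G g := fun c => by
    simp [MonoidAlgebra.of, MonoidAlgebra.smul_single]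
  rw [this, smul_assoc]
  exact AddSubgroup.zsmul_mem _ (word_mem_normLE bM (h z g (Finsupp.mem_support_iff.mp hg))) _

variable {bM} in
theorem words_of_mem_normLE {x : M} {m : ℤ} (hx : x ∈ normLE bM ℓ μ m) (z : X) (g : G)
    (h : (bM.repr x z).coeff g ≠ 0) : (ℓ g + μ z : ℤ) ≤ m := by
  induction hx using AddSubgroup.closure_induction generalizing z g with
  | mem x hx =>
    classical
    obtain ⟨g', z', hm, rfl⟩ := hx
    rw [map_smul, Module.Basis.repr_self, Finsupp.smul_single, Finsupp.single_apply] at h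
    split_ifs at h with hz
    · rw [smul_eq_mul, mul_one, MonoidAlgebra.of_apply, MonoidAlgebra.coeff_single,
        Finsupp.single_apply] at h
      split_ifs at h with hg
      · rwa [← hz, ← hg]
      · exact absurd rfl h
    · exact absurd rfl h
  | zero => simp at h
  | add x y _ _ hx hy =>
    by_cases h' : (bM.repr x z).coeff g ≠ 0
    · exact hx z g h'
    · refine hy z g fun h'' => h ?_
      rw [map_add, Finsupp.add_apply, MonoidAlgebra.coeff_add, Finsupp.add_apply, h'',
        not_not.mp h', add_zero]
  | neg x _ hx =>
    refine hx z g fun h' => h ?_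
    rw [map_neg, Finsupp.neg_apply, MonoidAlgebra.coeff_neg, Finsupp.neg_apply, h', neg_zero]

variable {bM} in
-- Passing from the norm to a subgroup generated by words makes the estimates provable by closure
-- induction.
theorem freeNorm_le_iff {x : M} (m : ℕ) :
    freeNorm bM ℓ μ x ≤ m ↔ x ∈ normLE bM ℓ μ m := by
  have : freeNorm bM ℓ μ x ≤ m ↔ ∀ z g, (bM.repr x z).coeff g ≠ 0 → ℓ g + μ z ≤ m := by
    simp only [freeNorm, Finset.sup_le_iff, Finsupp.mem_support_iff]
    refine forall_congr' fun z => ⟨fun h g hg => h ?_ g hg, fun h _ g hg => h g hg⟩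
    intro h0
    rw [h0] at hg
    exact hg rfl
  rw [this]
  refine ⟨fun h => mem_normLE_of_words fun z g hg => mod_cast h z g hg, fun h z g hg => ?_⟩
  exact_mod_cast words_of_mem_normLE h z g hg

variable {bM} in
-- The element 0 lies in `normLE` for negative m as well, whereas its `freeNorm` is the empty
-- supremum 0; hence `h0`.
theorem freeNorm_le_of_mem {x : M} {m : ℤ} (hx : x ∈ normLE bM ℓ μ m) (h0 : x ≠ 0) :
    (freeNorm bM ℓ μ x : ℤ) ≤ m := by
  rcases lt_or_ge m 0 with hm | hm
  · exfalso
    apply h0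
    rw [← bM.repr.map_eq_zero_iff]
    ext z g
    by_contra h
    have := words_of_mem_normLE hx z g h
    omega
  · lift m to ℕ using hm
    exact_mod_cast (freeNorm_le_iff m).mpr hx

variable {bM bN} in
theorem map_mem_normLE {φ : M →+ N} {i : ℤ}
    (h : ∀ x, φ x ≠ 0 → (freeNorm bN ℓ ν (φ x) : ℤ) ≤ freeNorm bM ℓ μ x + i) {x : M} {m : ℤ}
    (hx : x ∈ normLE bM ℓ μ m) : φ x ∈ normLE bN ℓ ν (m + i) := by
  by_cases h0 : φ x = 0
  · rw [h0]; exact AddSubgroup.zero_mem _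
  · have h1 : x ≠ 0 := fun h => h0 (by rw [h, map_zero])
    exact normLE_mono ((h x h0).trans (add_le_add_left (freeNorm_le_of_mem hx h1) i))
      ((freeNorm_le_iff _).mp le_rfl)

variable {bM} in
theorem of_smul_mem_normLE (hℓ : IsGroupNorm ℓ) (g : G) {x : M} {m : ℤ}
    (hx : x ∈ normLE bM ℓ μ m) : MonoidAlgebra.of ℤ G g • x ∈ normLE bM ℓ μ (ℓ g + m) := by
  induction hx using AddSubgroup.closure_induction with
  | mem x hx =>
    obtain ⟨g', z, hm, rfl⟩ := hx
    rw [smul_smul, ← map_mul]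
    refine word_mem_normLE bM ?_
    have : (ℓ (g * g') : ℤ) ≤ ℓ g + ℓ g' := by exact_mod_cast hℓ.2 g g'
    linarith
  | zero => rw [smul_zero]; exact AddSubgroup.zero_mem _
  | add x y _ _ hx hy => rw [smul_add]; exact AddSubgroup.add_mem _ hx hy
  | neg x _ hx => rw [smul_neg]; exact AddSubgroup.neg_mem _ hx

variable {bM bN} in
-- By subadditivity of the group norm, a ZG-linear map need only be estimated on generators.
theorem linearMap_mem_normLE (hℓ : IsGroupNorm ℓ) {φ : M →ₗ[ZG G] N} {i : ℤ}
    (h : ∀ z, φ (bM z) ∈ normLE bN ℓ ν (μ z + i)) {x : M} {m : ℤ}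
    (hx : x ∈ normLE bM ℓ μ m) : φ x ∈ normLE bN ℓ ν (m + i) := by
  induction hx using AddSubgroup.closure_induction with
  | mem x hx =>
    obtain ⟨g, z, hm, rfl⟩ := hx
    rw [map_smul]
    exact normLE_mono (by linarith) (of_smul_mem_normLE hℓ g (h z))
  | zero => rw [map_zero]; exact AddSubgroup.zero_mem _
  | add x y _ _ hx hy => rw [map_add]; exact AddSubgroup.add_mem _ hx hy
  | neg x _ hx => rw [map_neg]; exact AddSubgroup.neg_mem _ hx

theorem basis_mem_normLE (hℓ : IsGroupNorm ℓ) (z : X) : bM z ∈ normLE bM ℓ μ (μ z) := by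
  have := word_mem_normLE bM (ℓ := ℓ) (μ := μ) (g := 1) (z := z) (m := μ z)
    (by rw [(hℓ.1 1).mpr rfl]; simp)
  rwa [map_one, one_smul] at this

variable {bM} in
/-- On coinvariants, the words of norm at most `m` become generators of norm at most `m`. -/
theorem augCoords_mem_span {x : M} {m : ℕ} (hx : x ∈ normLE bM ℓ μ m) :
    augCoords bM x ∈ Submodule.span ℤ {y : X →₀ ℤ | ∃ z, μ z ≤ m ∧ y = Finsupp.single z 1} := by
  induction hx using AddSubgroup.closure_induction with
  | mem x hx =>
    obtain ⟨g, z, hm, rfl⟩ := hx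
    refine Submodule.subset_span ⟨z, by omega, ?_⟩
    rw [map_smulₛₗ, augCoords_basis]
    change aug G _ • _ = _
    rw [aug_of, one_smul]
  | zero => rw [map_zero]; exact Submodule.zero_mem _
  | add x y _ _ hx hy => rw [map_add]; exact Submodule.add_mem _ hx hy
  | neg x _ hx => rw [map_neg]; exact Submodule.neg_mem _ hx

end Filtration

/-! ### Norm estimates for the bar resolution -/

section BarNorm

variable {G : Type*} [Group G] {ℓ : G → ℕ}

/-- The norm `‖g₁‖ + ⋯ + ‖gₙ‖` of a generator of the bar resolution. -/
def simpNorm (ℓ : G → ℕ) (n : ℕ) (x : Simp G n) : ℕ := ∑ i, ℓ (x.1 i)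

theorem sum_face_succ_le (hℓ : IsGroupNorm ℓ) {n : ℕ} (j : Fin (n + 1)) (x : Fin (n + 1) → G) :
    ∑ i, ℓ (face j.succ x i) ≤ ∑ i, ℓ (x i) := by
  induction n with
  | zero => simp
  | succ n ih =>
    rw [← Fin.cons_self_tail x]
    generalize x 0 = g
    generalize Fin.tail x = y
    cases j using Fin.cases with
    | zero =>
      rw [face_one_cons, Fin.sum_univ_succ, Fin.sum_univ_succ, Fin.sum_univ_succ (n := n)]
      simp only [Fin.cons_zero, Fin.cons_succ, face_zero]
      have := hℓ.2 g (y 0)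
      omega
    | succ j =>
      rw [face_succ_succ_cons, Fin.sum_univ_succ, Fin.sum_univ_succ (n := n + 1)]
      simp only [Fin.cons_zero, Fin.cons_succ]
      have := ih j y
      omega

theorem barElt_of_mem_normLE {n : ℕ} {g : G} {x : Fin n → G} {m : ℤ}
    (h : ((ℓ g + ∑ i, ℓ (x i) : ℕ) : ℤ) ≤ m) :
    barElt (MonoidAlgebra.of ℤ G g) x ∈ normLE (barBasis G n) ℓ (simpNorm ℓ n) m := by
  by_cases hx : ∀ i, x i ≠ 1
  · lift x to Simp G n using hx
    rw [barElt_eq_smul_basis]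
    exact word_mem_normLE _ (by exact_mod_cast h)
  · rw [barElt, dif_neg hx]
    exact AddSubgroup.zero_mem _

theorem barElt_one_mem_normLE (hℓ : IsGroupNorm ℓ) {n : ℕ} {x : Fin n → G} {m : ℤ}
    (h : ((∑ i, ℓ (x i) : ℕ) : ℤ) ≤ m) :
    barElt 1 x ∈ normLE (barBasis G n) ℓ (simpNorm ℓ n) m := by
  rw [← map_one (MonoidAlgebra.of ℤ G)]
  exact barElt_of_mem_normLE (by rwa [(hℓ.1 1).mpr rfl, zero_add])

/-- In g₁[g₂|⋯] the entry g₁ becomes a coefficient, and its norm is still counted; the other faces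
multiply neighbours or drop the last entry. -/
theorem barDiff_mem_normLE (hℓ : IsGroupNorm ℓ) {n : ℕ} {x : Bar G (n + 1)} {m : ℤ}
    (hx : x ∈ normLE (barBasis G (n + 1)) ℓ (simpNorm ℓ (n + 1)) m) :
    (barRes G).d n x ∈ normLE (barBasis G n) ℓ (simpNorm ℓ n) m := by
  rw [← add_zero m]
  refine linearMap_mem_normLE hℓ (fun z => ?_) hx
  rw [add_zero, barBasis_apply]
  change barDiff G n _ ∈ _
  rw [barDiff_barElt _ z.2, one_smul]
  refine AddSubgroup.add_mem _ (barElt_of_mem_normLE ?_)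
    (AddSubgroup.sum_mem _ fun j _ => AddSubgroup.zsmul_mem _ (barElt_one_mem_normLE hℓ ?_) _)
  · rw [simpNorm, Fin.sum_univ_succ]
    rfl
  · exact_mod_cast sum_face_succ_le hℓ j z.1

theorem barRes_h_mem_normLE (hℓ : IsGroupNorm ℓ) {n : ℕ} {x : Bar G n} {m : ℤ}
    (hx : x ∈ normLE (barBasis G n) ℓ (simpNorm ℓ n) m) :
    (barRes G).h n x ∈ normLE (barBasis G (n + 1)) ℓ (simpNorm ℓ (n + 1)) m := by
  induction hx using AddSubgroup.closure_induction with
  | mem x hx =>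
    obtain ⟨g, z, hm, rfl⟩ := hx
    rw [← barElt_eq_smul_basis, barRes_h]
    refine barElt_one_mem_normLE hℓ ?_
    rw [Fin.sum_univ_succ]
    simpa [simpNorm] using hm
  | zero => rw [map_zero]; exact AddSubgroup.zero_mem _
  | add x y _ _ hx hy => rw [map_add]; exact AddSubgroup.add_mem _ hx hy
  | neg x _ hx => rw [map_neg]; exact AddSubgroup.neg_mem _ hx

variable {P : ℕ → Type*} [∀ n, AddCommGroup (P n)] [∀ n, Module (ZG G) (P n)]
  {Z : ℕ → Type*} [Unique (Z 0)] (b : ∀ n, Module.Basis (Z n) (ZG G) (P n)) {R : ResData G P}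

/-- The homotopy from `1` to `g f` on the bar resolution does not increase the norm. -/
theorem homotopyTo_bar_mem_normLE (hR : R.IsFreeResolution) (hℓ : IsGroupNorm ℓ)
    (hc : NormCompatible b R ℓ) (n : ℕ) (z : Simp G n) :
    homotopyTo (barBasis G) (barRes G)
      (fun n => compare b R (barRes G) n ∘ₗ compare (barBasis G) (barRes G) R n) n
        (barBasis G n z) ∈
      normLE (barBasis G (n + 1)) ℓ (simpNorm ℓ (n + 1)) (simpNorm ℓ n z) := by
  obtain ⟨ν, hν0, hν⟩ := hc
  choose i hh hd using hν
  replace hh : ∀ n m x, x ∈ normLE (b n) ℓ (ν n) m →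
      R.h n x ∈ normLE (b (n + 1)) ℓ (ν (n + 1)) (m - i n) := by
    intro n m x hx
    rw [sub_eq_add_neg]
    exact map_mem_normLE (fun x h0 => by rw [← sub_eq_add_neg]; exact hh n x h0) hx
  replace hd : ∀ n m x, x ∈ normLE (b (n + 1)) ℓ (ν (n + 1)) m →
      R.d n x ∈ normLE (b n) ℓ (ν n) (m + i n) := fun n m x hx =>
    map_mem_normLE (φ := (R.d n).toAddMonoidHom) (hd n) hx
  -- the values of `h_{-1}`
  have hunit : IsUnit (R.ε (b 0 default)) := by
    have h1 := hR.ε_hneg 1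
    rw [← (b 0).linearCombination_repr (R.hneg 1), Finsupp.linearCombination_unique, hR.ε_smul,
      mul_comm] at h1
    exact IsUnit.of_mul_eq_one _ h1
  -- As F₀ has the single generator b, ε(b) divides ε(h₋₁(1)) = 1 and is ±1. So h₋₁(1) = ±(b -
  -- d₁h₀b), and in d₁h₀ the shifts -i₀ and i₀ cancel.
  have hneg : R.hneg 1 ∈ normLE (b 0) ℓ (ν 0) 0 := by
    have h0 : b 0 default ∈ normLE (b 0) ℓ (ν 0) 0 := by
      have := basis_mem_normLE (b 0) hℓ (μ := ν 0) default
      rwa [hν0] at this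
    have h1 : R.hneg (R.ε (b 0 default)) ∈ normLE (b 0) ℓ (ν 0) 0 := by
      rw [eq_sub_of_add_eq (hR.homotopy_zero (b 0 default))]
      refine AddSubgroup.sub_mem _ h0 ?_
      have := hd 0 _ _ (hh 0 _ _ h0)
      rwa [sub_add_cancel] at this
    rcases Int.isUnit_iff.mp hunit with h | h <;> rw [h] at h1
    · exact h1
    · rwa [map_neg, AddSubgroup.neg_mem_iff] at h1
  -- the comparison maps
  set I : ℕ → ℤ := fun n => ∑ j ∈ Finset.range n, i j with hI
  have hIs : ∀ n, I (n + 1) = I n + i n := fun n => Finset.sum_range_succ _ _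
  -- Each degree adds to f one hₙ, with shift -iₙ, while the bar differential is free; for g it adds
  -- one dₙ₊₁, with shift iₙ, while h' is free.
  have hf : ∀ n m x, x ∈ normLE (barBasis G n) ℓ (simpNorm ℓ n) m →
      compare (barBasis G) (barRes G) R n x ∈ normLE (b n) ℓ (ν n) (m + -I n) := by
    intro n
    induction n with
    | zero =>
      intro m x hx
      refine linearMap_mem_normLE hℓ (fun z => ?_) hx
      rw [compare, Module.Basis.constr_basis, barBasis_apply, ← map_one (MonoidAlgebra.of ℤ G),
        barRes_ε]
      exact normLE_mono (by simp [hI]) hneg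
    | succ n ih =>
      intro m x hx
      refine linearMap_mem_normLE hℓ (fun z => ?_) hx
      rw [compare, Module.Basis.constr_basis]
      refine normLE_mono ?_ (hh _ _ _ (ih _ _ (barDiff_mem_normLE hℓ (basis_mem_normLE _ hℓ z))))
      rw [hIs]
      linarith
  have hg : ∀ n m x, x ∈ normLE (b n) ℓ (ν n) m →
      compare b R (barRes G) n x ∈ normLE (barBasis G n) ℓ (simpNorm ℓ n) (m + I n) := by
    intro n
    induction n with
    | zero =>
      intro m x hx
      refine linearMap_mem_normLE hℓ (fun z => ?_) hx
      rw [compare, Module.Basis.constr_basis]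
      refine AddSubgroup.zsmul_mem _ (barElt_one_mem_normLE hℓ ?_) _
      simp [hI, hν0]
    | succ n ih =>
      intro m x hx
      refine linearMap_mem_normLE hℓ (fun z => ?_) hx
      rw [compare, Module.Basis.constr_basis]
      refine normLE_mono ?_ (barRes_h_mem_normLE hℓ (ih _ _ (hd _ _ _ (basis_mem_normLE _ hℓ z))))
      rw [hIs]
      linarith
  have hgf : ∀ n m x, x ∈ normLE (barBasis G n) ℓ (simpNorm ℓ n) m →
      compare b R (barRes G) n (compare (barBasis G) (barRes G) R n x) ∈
        normLE (barBasis G n) ℓ (simpNorm ℓ n) m := by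
    intro n m x hx
    have := hg _ _ _ (hf _ _ _ hx)
    rwa [neg_add_cancel_right] at this
  induction n with
  | zero =>
    rw [homotopyTo, Module.Basis.constr_basis]
    have h0 := basis_mem_normLE (barBasis G 0) hℓ (μ := simpNorm ℓ 0) z
    exact barRes_h_mem_normLE hℓ (AddSubgroup.sub_mem _ h0 (hgf _ _ _ h0))
  | succ n ih =>
    rw [homotopyTo, Module.Basis.constr_basis]
    have h0 := basis_mem_normLE (barBasis G (n + 1)) hℓ (μ := simpNorm ℓ (n + 1)) z
    refine barRes_h_mem_normLE hℓ (AddSubgroup.sub_mem _ (AddSubgroup.sub_mem _ h0 (hgf _ _ _ h0)) ?_)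
    have := linearMap_mem_normLE hℓ (i := 0) (fun z => by rw [add_zero]; exact ih z)
      (barDiff_mem_normLE hℓ h0)
    rwa [add_zero] at this

end BarNorm

/-- The elements are c ↦ (c,0,0) ↦ (0,c,0) ↦ k'c. This reduces both nilpotency claims from the
cylinder to k'. -/
theorem cylEquiv_f_h_g {C : ℕ → Type u} {E : ℕ → Type v} [∀ n, AddCommGroup (C n)]
    [∀ n, AddCommGroup (E n)] (dC : ∀ n, C (n + 1) →ₗ[ℤ] C n) (dE : ∀ n, E (n + 1) →ₗ[ℤ] E n)
    (f : ∀ n, C n →ₗ[ℤ] E n) (g : ∀ n, E n →ₗ[ℤ] C n)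
    (k : ∀ n, E n →ₗ[ℤ] E (n + 1)) (k' : ∀ n, C n →ₗ[ℤ] C (n + 1)) (n : ℕ) :
    (cylEquiv dC dE f g k k').ρ₁.f (n + 1) ∘ₗ (cylEquiv dC dE f g k k').ρ₂.h n ∘ₗ
      (cylEquiv dC dE f g k k').ρ₁.g n = k' n := by
  refine LinearMap.ext fun c => ?_
  change (cylLeft dC dE f g k k').f (n + 1) ((cylRight f).h n ((cylLeft dC dE f g k k').g n c)) = _
  rw [cylLeft_g, cylRight_h, cylLeft_f_succ, map_zero, add_zero, zero_add]

/-! ### Local nilpotency -/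

section LocallyNilpotent

variable {A : Type*} [Ring A] {M N : Type*} [AddCommGroup M] [Module A M] [AddCommGroup N]
  [Module A N]

/-- This is (βα)^(m+1) = β(αβ)^m α. -/
theorem LocallyNilpotent.comp_swap {α : M →ₗ[A] N} {β : N →ₗ[A] M}
    (h : LocallyNilpotent (α ∘ₗ β)) : LocallyNilpotent (β ∘ₗ α) := by
  intro x
  obtain ⟨m, hm⟩ := h (α x)
  have key : ∀ m, α ((β ∘ₗ α)^[m] x) = (α ∘ₗ β)^[m] (α x) := fun m =>
    Function.Semiconj.iterate_right (f := α) (ga := β ∘ₗ α) (gb := α ∘ₗ β) (fun _ => rfl) m x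
  refine ⟨m + 1, ?_⟩
  rw [Function.iterate_succ_apply', LinearMap.comp_apply, key, hm, map_zero]

/-- The weights ν are natural numbers and β lowers them strictly, so β^m kills the span of the
generators of weight less than m. -/
theorem locallyNilpotent_of_lt {X : Type*} {e : X → M} (he : Submodule.span A (Set.range e) = ⊤)
    (ν : X → ℕ) {β : M →ₗ[A] M}
    (h : ∀ x, β (e x) ∈ Submodule.span A {w | ∃ y, ν y < ν x ∧ w = e y}) :
    LocallyNilpotent β := by
  have key : ∀ m, ∀ w ∈ Submodule.span A {w | ∃ y, ν y < m ∧ w = e y}, (β ^ m) w = 0 := by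
    intro m
    induction m with
    | zero =>
      intro w hw
      have : {w | ∃ y, ν y < 0 ∧ w = e y} = ∅ := by ext; simp
      rw [this, Submodule.span_empty] at hw
      rw [(Submodule.mem_bot A).mp hw, map_zero]
    | succ m ih =>
      intro w hw
      have hle : Submodule.span A {w | ∃ y, ν y < m + 1 ∧ w = e y} ≤
          LinearMap.ker (β ^ (m + 1)) := by
        rw [Submodule.span_le]
        rintro _ ⟨y, hy, rfl⟩
        rw [SetLike.mem_coe, LinearMap.mem_ker, pow_succ, Module.End.mul_apply]
        refine ih _ (Submodule.span_mono ?_ (h y))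
        rintro _ ⟨z, hz, rfl⟩
        exact ⟨z, by omega, rfl⟩
      exact hle hw
  intro x
  have hx : x ∈ Submodule.span A (Set.range e) := he ▸ Submodule.mem_top
  suffices ∃ m, (β ^ m) x = 0 by simpa only [Module.End.pow_apply] using this
  induction hx using Submodule.span_induction with
  | mem x hx =>
    obtain ⟨y, rfl⟩ := hx
    exact ⟨ν y + 1, key _ _ (Submodule.subset_span ⟨y, Nat.lt_succ_self _, rfl⟩)⟩
  | zero => exact ⟨0, map_zero _⟩
  | add x y _ _ hx hy =>
    obtain ⟨m, hm⟩ := hx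
    obtain ⟨k, hk⟩ := hy
    refine ⟨m + k, ?_⟩
    rw [map_add, add_comm m k, pow_add, Module.End.mul_apply, hm, map_zero, zero_add, ← pow_mul_comm,
      Module.End.mul_apply, hk, map_zero]
  | smul a x _ hx =>
    obtain ⟨m, hm⟩ := hx
    exact ⟨m, by rw [map_smul, hm, smul_zero]⟩

end LocallyNilpotent

/-! ### The last face and the twisting perturbation -/

section Perturbation

variable {G : Type*} [Group G] {ℓ : G → ℕ}

/-- The simplex `[g₁|⋯|gₙ]`, for the simplex `[g₁|⋯|gₙ₊₁]`. -/
def simpInit {n : ℕ} (x : Simp G (n + 1)) : Simp G n :=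
  ⟨Fin.init x.1, fun i => x.2 i.castSucc⟩

theorem lastFace_single {n : ℕ} (x : Simp G (n + 1)) :
    lastFace G n (Finsupp.single x 1) =
      Finsupp.single (simpInit x) 1 := by
  rw [lastFace, faceMap, Finsupp.linearCombination_single, one_smul, face_succ_last]
  exact dif_pos (simpInit x).2

/-- Strict because the deleted entry of a nondegenerate simplex is not 1, and only 1 has norm 0. -/
theorem simpNorm_init_lt (hℓ : IsGroupNorm ℓ) {n : ℕ} (x : Simp G (n + 1)) :
    simpNorm ℓ n (simpInit x) < simpNorm ℓ (n + 1) x := by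
  rw [simpNorm, simpNorm, Fin.sum_univ_castSucc]
  have : ℓ (x.1 (Fin.last n)) ≠ 0 := fun h => x.2 _ ((hℓ.1 _).mp h)
  simp only [simpInit, Fin.init]
  omega

theorem locallyNilpotent_lastFace_comp (hℓ : IsGroupNorm ℓ) {n : ℕ}
    {k : Chains G n →ₗ[ℤ] Chains G (n + 1)}
    (hk : ∀ x, k (Finsupp.single x 1) ∈
      Submodule.span ℤ {y | ∃ z, simpNorm ℓ (n + 1) z ≤ simpNorm ℓ n x ∧ y = Finsupp.single z 1}) :
    LocallyNilpotent (lastFace G n ∘ₗ k) := by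
  refine locallyNilpotent_of_lt (e := fun x => Finsupp.single x 1)
    (Finsupp.basisSingleOne (R := ℤ)).span_eq (simpNorm ℓ n) fun x => ?_
  rw [LinearMap.comp_apply, ← Submodule.mem_comap]
  refine (Submodule.span_le.mpr ?_) (hk x)
  rintro _ ⟨z, hz, rfl⟩
  rw [SetLike.mem_coe, Submodule.mem_comap, lastFace_single]
  exact Submodule.subset_span ⟨simpInit z, (simpNorm_init_lt hℓ z).trans_le hz, rfl⟩

theorem twPert_tmul_single {n : ℕ} (a : ZG G) (x : Simp G (n + 1)) :
    twPert G n (a ⊗ₜ Finsupp.single x 1) =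
      (-1 : ℤ) ^ (n + 1) • ((a * (MonoidAlgebra.of ℤ G (x.1 (Fin.last n))⁻¹ - 1)) ⊗ₜ[ℤ]
        lastFace G n (Finsupp.single x 1)) := by
  classical
  rw [twPert, LinearMap.comp_apply, LinearEquiv.coe_coe]
  erw [TensorProduct.finsuppScalarRight_apply_tmul]
  rw [Finsupp.sum_single_index (by simp), one_smul, Finsupp.linearCombination_single,
    smul_comm, TensorProduct.smul_tmul', smul_eq_mul]

theorem span_one_tmul_single {X : Type*} :
    Submodule.span (ZG G) (Set.range fun x : X => (1 : ZG G) ⊗ₜ[ℤ] (Finsupp.single x (1 : ℤ))) =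
      ⊤ := by
  have := (Algebra.TensorProduct.basis (ZG G)
    (Finsupp.basisSingleOne (R := ℤ) (ι := X))).span_eq
  convert this using 3
  ext x
  simp

/-- Coefficients in ZG are not weighed: the map is ZG-linear, so only the norm of the simplices has
to decrease. -/
theorem locallyNilpotent_twPert_comp (hℓ : IsGroupNorm ℓ) {n : ℕ}
    {k : Chains G n →ₗ[ℤ] Chains G (n + 1)}
    (hk : ∀ x, k (Finsupp.single x 1) ∈
      Submodule.span ℤ {y | ∃ z, simpNorm ℓ (n + 1) z ≤ simpNorm ℓ n x ∧ y = Finsupp.single z 1}) :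
    LocallyNilpotent (twPert G n ∘ₗ k.baseChange (ZG G)) := by
  refine locallyNilpotent_of_lt (e := fun x => (1 : ZG G) ⊗ₜ[ℤ] Finsupp.single x 1)
    span_one_tmul_single (simpNorm ℓ n) fun x => ?_
  rw [LinearMap.comp_apply, LinearMap.baseChange_tmul]
  have := hk x
  generalize k (Finsupp.single x 1) = y at this ⊢
  induction this using Submodule.span_induction with
  | mem y hy =>
    obtain ⟨z, hz, rfl⟩ := hy
    rw [twPert_tmul_single, lastFace_single, one_mul,
      ← mul_one (MonoidAlgebra.of ℤ G (z.1 (Fin.last n))⁻¹ - 1), ← smul_eq_mul,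
      ← TensorProduct.smul_tmul']
    refine zsmul_mem ?_ _
    exact Submodule.smul_mem _ _ (Submodule.subset_span
      ⟨simpInit z, (simpNorm_init_lt hℓ z).trans_le hz, rfl⟩)
  | zero => rw [TensorProduct.tmul_zero, map_zero]; exact Submodule.zero_mem _
  | add y z _ _ hy hz =>
    rw [TensorProduct.tmul_add, map_add]
    exact Submodule.add_mem _ hy hz
  | smul m y _ hy =>
    rw [TensorProduct.tmul_smul, map_zsmul]
    exact zsmul_mem hy _

variable {P : ℕ → Type*} [∀ n, AddCommGroup (P n)] [∀ n, Module (ZG G) (P n)]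
  {Z : ℕ → Type*} (b : ∀ n, Module.Basis (Z n) (ZG G) (P n)) {R : ResData G P}

theorem effHom_f_h_g (n : ℕ) :
    (effHom b R).ρ₁.f (n + 1) ∘ₗ (effHom b R).ρ₂.h n ∘ₗ (effHom b R).ρ₁.g n =
      coinv (barBasis G n) (barBasis G (n + 1)) (homotopyTo (barBasis G) (barRes G)
        (fun n => compare b R (barRes G) n ∘ₗ compare (barBasis G) (barRes G) R n) n) := by
  unfold effHom
  exact cylEquiv_f_h_g _ _ _ _ _ _ n

variable [Unique (Z 0)]

theorem effHom_homotopy_mem_span (hR : R.IsFreeResolution) (hℓ : IsGroupNorm ℓ)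
    (hc : NormCompatible b R ℓ) (n : ℕ) (x : Simp G n) :
    ((effHom b R).ρ₁.f (n + 1) ∘ₗ (effHom b R).ρ₂.h n ∘ₗ (effHom b R).ρ₁.g n)
      (Finsupp.single x 1) ∈
      Submodule.span ℤ {y | ∃ z, simpNorm ℓ (n + 1) z ≤ simpNorm ℓ n x ∧
        y = Finsupp.single z 1} := by
  rw [effHom_f_h_g, coinv_single]
  exact augCoords_mem_span (homotopyTo_bar_mem_normLE b hR hℓ hc n x)

theorem effHom_locallyNilpotent_lastFace (hR : R.IsFreeResolution) (hℓ : IsGroupNorm ℓ)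
    (hc : NormCompatible b R ℓ) (n : ℕ) :
    LocallyNilpotent ((effHom b R).ρ₂.h n ∘ₗ (effHom b R).ρ₁.g n ∘ₗ lastFace G n ∘ₗ
      (effHom b R).ρ₁.f (n + 1)) := by
  have h := locallyNilpotent_lastFace_comp hℓ (effHom_homotopy_mem_span b hR hℓ hc n)
  exact LocallyNilpotent.comp_swap (α := lastFace G n ∘ₗ (effHom b R).ρ₁.f (n + 1))
    (β := (effHom b R).ρ₂.h n ∘ₗ (effHom b R).ρ₁.g n) h

theorem effHom_locallyNilpotent_pertEnd (hR : R.IsFreeResolution) (hℓ : IsGroupNorm ℓ)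
    (hc : NormCompatible b R ℓ) (n : ℕ) : LocallyNilpotent (pertEnd (effHom b R) n) := by
  have h := locallyNilpotent_twPert_comp hℓ (effHom_homotopy_mem_span b hR hℓ hc n)
  rw [LinearMap.baseChange_comp, LinearMap.baseChange_comp] at h
  exact LocallyNilpotent.comp_swap
    (α := twPert G n ∘ₗ ((effHom b R).ρ₁.f (n + 1)).baseChange (ZG G))
    (β := ((effHom b R).ρ₂.h n).baseChange (ZG G) ∘ₗ ((effHom b R).ρ₁.g n).baseChange (ZG G)) h

end Perturbation

/-! ### The alternating series -/

section AltSum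

variable {A : Type*} [Ring A] {M : Type*} [AddCommGroup M] [Module A M]

theorem altSum_eq_sum (α : M →ₗ[A] M) (hα : LocallyNilpotent α) {x : M} {m : ℕ}
    (hm : α^[m] x = 0) : altSum α hα x = ∑ i ∈ Finset.range m, ((-α) ^ i) x := by
  change ∑ᶠ i : ℕ, ((-α) ^ i) x = _
  refine finsum_eq_sum_of_support_subset _ fun i hi => ?_
  by_contra hlt
  rw [Finset.mem_coe, Finset.mem_range, not_lt] at hlt
  obtain ⟨j, rfl⟩ := Nat.exists_eq_add_of_le hlt
  refine hi ?_
  have h0 : (α ^ m) x = 0 := by rw [Module.End.pow_apply]; exact hm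
  change ((-α) ^ (m + j)) x = 0
  rw [neg_pow, add_comm m j, pow_add α]
  simp [h0]

/-- Truncating at m for αx and at m + 1 for x makes the sums match up to sign and the term x of
index 0. -/
theorem altSum_eq_sub (α : M →ₗ[A] M) (hα : LocallyNilpotent α) (x : M) :
    altSum α hα (α x) = x - altSum α hα x := by
  obtain ⟨m, hm⟩ := hα x
  have h1 : α^[m] (α x) = 0 := by
    rw [← Function.iterate_succ_apply, Function.iterate_succ_apply', hm, map_zero]
  have h2 : α^[m + 1] x = 0 := h1
  rw [altSum_eq_sum α hα h1, altSum_eq_sum α hα h2, Finset.sum_range_succ']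
  simp only [pow_succ (-α), Module.End.mul_apply, LinearMap.neg_apply, map_neg,
    Finset.sum_neg_distrib, pow_zero, Module.End.one_apply]
  abel

theorem map_altSum (α : M →ₗ[A] M) (hα : LocallyNilpotent α) (x : M) :
    α (altSum α hα x) = altSum α hα (α x) := by
  obtain ⟨m, hm⟩ := hα x
  have h1 : α^[m] (α x) = 0 := by
    rw [← Function.iterate_succ_apply, Function.iterate_succ_apply', hm, map_zero]
  rw [altSum_eq_sum α hα h1, altSum_eq_sum α hα hm, map_sum]
  refine Finset.sum_congr rfl fun i _ => ?_
  have : Commute α ((-α) ^ i) := ((Commute.refl α).neg_right).pow_right i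
  exact DFunLike.congr_fun this x

theorem map_altSum_eq_sub (α : M →ₗ[A] M) (hα : LocallyNilpotent α) (x : M) :
    α (altSum α hα x) = x - altSum α hα x := by
  rw [map_altSum, altSum_eq_sub]

end AltSum

/-! ### The perturbation lemma -/

section PerturbationLemma

variable {A : Type*} [Ring A] {D : ℕ → Type*} {E : ℕ → Type*}
  [∀ n, AddCommGroup (D n)] [∀ n, Module A (D n)] [∀ n, AddCommGroup (E n)] [∀ n, Module A (E n)]

/-- The axioms of a reduction `(f, g, h)` from `(D, d)` to `(E, dE)`, for modules over a ring. -/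
structure IsLinearReduction (d : ∀ n, D (n + 1) →ₗ[A] D n) (dE : ∀ n, E (n + 1) →ₗ[A] E n)
    (f : ∀ n, D n →ₗ[A] E n) (g : ∀ n, E n →ₗ[A] D n) (h : ∀ n, D n →ₗ[A] D (n + 1)) : Prop where
  f_d : ∀ n x, f n (d n x) = dE n (f (n + 1) x)
  g_d : ∀ n y, g n (dE n y) = d n (g (n + 1) y)
  f_g : ∀ n y, f n (g n y) = y
  homotopy_zero : ∀ x, d 0 (h 0 x) = x - g 0 (f 0 x)
  homotopy_succ : ∀ n x, d (n + 1) (h (n + 1) x) + h n (d n x) = x - g (n + 1) (f (n + 1) x)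
  f_h : ∀ n x, f (n + 1) (h n x) = 0
  h_g : ∀ n y, h n (g n y) = 0
  h_h : ∀ n x, h (n + 1) (h n x) = 0

theorem RedData.IsReduction.baseChange {S : Type*} [Ring S] {C : ℕ → Type*} {D : ℕ → Type*}
    [∀ n, AddCommGroup (C n)] [∀ n, AddCommGroup (D n)] {ρ : RedData C D}
    {dC : ∀ n, C (n + 1) →ₗ[ℤ] C n} {dD : ∀ n, D (n + 1) →ₗ[ℤ] D n} (h : ρ.IsReduction dC dD) :
    IsLinearReduction (fun n => (dC n).baseChange S) (fun n => (dD n).baseChange S)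
      (fun n => (ρ.f n).baseChange S) (fun n => (ρ.g n).baseChange S)
      (fun n => (ρ.h n).baseChange S) where
  f_d n x := by
    have : ρ.f n ∘ₗ dC n = dD n ∘ₗ ρ.f (n + 1) := LinearMap.ext (h.f_d n)
    rw [← LinearMap.comp_apply, ← LinearMap.baseChange_comp, this, LinearMap.baseChange_comp,
      LinearMap.comp_apply]
  g_d n x := by
    have : ρ.g n ∘ₗ dD n = dC n ∘ₗ ρ.g (n + 1) := LinearMap.ext (h.g_d n)
    rw [← LinearMap.comp_apply, ← LinearMap.baseChange_comp, this, LinearMap.baseChange_comp,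
      LinearMap.comp_apply]
  f_g n x := by
    have : ρ.f n ∘ₗ ρ.g n = LinearMap.id := LinearMap.ext (h.f_g n)
    rw [← LinearMap.comp_apply, ← LinearMap.baseChange_comp, this, LinearMap.baseChange_id,
      LinearMap.id_apply]
  homotopy_zero x := by
    have : dC 0 ∘ₗ ρ.h 0 = LinearMap.id - ρ.g 0 ∘ₗ ρ.f 0 := LinearMap.ext h.homotopy_zero
    rw [← LinearMap.comp_apply, ← LinearMap.baseChange_comp, this, LinearMap.baseChange_sub,
      LinearMap.baseChange_comp, LinearMap.baseChange_id]
    rfl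
  homotopy_succ n x := by
    have : dC (n + 1) ∘ₗ ρ.h (n + 1) + ρ.h n ∘ₗ dC n =
      LinearMap.id - ρ.g (n + 1) ∘ₗ ρ.f (n + 1) := LinearMap.ext (h.homotopy_succ n)
    rw [← LinearMap.comp_apply, ← LinearMap.comp_apply, ← LinearMap.baseChange_comp,
      ← LinearMap.baseChange_comp, ← LinearMap.add_apply, ← LinearMap.baseChange_add, this,
      LinearMap.baseChange_sub, LinearMap.baseChange_comp, LinearMap.baseChange_id]
    rfl
  f_h n x := by
    have : ρ.f (n + 1) ∘ₗ ρ.h n = 0 := LinearMap.ext (h.f_h n)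
    rw [← LinearMap.comp_apply, ← LinearMap.baseChange_comp, this, LinearMap.baseChange_zero,
      LinearMap.zero_apply]
  h_g n x := by
    have : ρ.h n ∘ₗ ρ.g n = 0 := LinearMap.ext (h.h_g n)
    rw [← LinearMap.comp_apply, ← LinearMap.baseChange_comp, this, LinearMap.baseChange_zero,
      LinearMap.zero_apply]
  h_h n x := by
    have : ρ.h (n + 1) ∘ₗ ρ.h n = 0 := LinearMap.ext (h.h_h n)
    rw [← LinearMap.comp_apply, ← LinearMap.baseChange_comp, this, LinearMap.baseChange_zero,
      LinearMap.zero_apply]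

theorem IsDifferential.baseChange {S : Type*} [Ring S] {C : ℕ → Type*} [∀ n, AddCommGroup (C n)]
    {d : ∀ n, C (n + 1) →ₗ[ℤ] C n} (h : IsDifferential d) (n : ℕ) (x : S ⊗[ℤ] C (n + 2)) :
    (d n).baseChange S ((d (n + 1)).baseChange S x) = 0 := by
  have : d n ∘ₗ d (n + 1) = 0 := LinearMap.ext (h n)
  rw [← LinearMap.comp_apply, ← LinearMap.baseChange_comp, this, LinearMap.baseChange_zero,
    LinearMap.zero_apply]

/-- The hypotheses of the perturbation lemma: `d + δ` is a differential and `Φ` is the inverse of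
`1 + h δ`. -/
structure IsPerturbation (d δ : ∀ n, D (n + 1) →ₗ[A] D n) (dE : ∀ n, E (n + 1) →ₗ[A] E n)
    (f : ∀ n, D n →ₗ[A] E n) (g : ∀ n, E n →ₗ[A] D n) (h : ∀ n, D n →ₗ[A] D (n + 1))
    (Φ : ∀ n, D n →ₗ[A] D n) : Prop extends IsLinearReduction d dE f g h where
  d_d : ∀ n x, d n (d (n + 1) x) = 0
  pert_d_d : ∀ n x, d n (d (n + 1) x + δ (n + 1) x) + δ n (d (n + 1) x + δ (n + 1) x) = 0
  Φ_zero : ∀ x, Φ 0 x = x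
  Φ_left : ∀ n x, Φ (n + 1) x = x - h n (δ n (Φ (n + 1) x))
  Φ_right : ∀ n x, Φ (n + 1) (h n (δ n x)) = x - Φ (n + 1) x

namespace IsPerturbation

variable {d δ : ∀ n, D (n + 1) →ₗ[A] D n} {dE : ∀ n, E (n + 1) →ₗ[A] E n}
  {f : ∀ n, D n →ₗ[A] E n} {g : ∀ n, E n →ₗ[A] D n} {h : ∀ n, D n →ₗ[A] D (n + 1)}
  {Φ : ∀ n, D n →ₗ[A] D n}

theorem h_δ_Φ (p : IsPerturbation d δ dE f g h Φ) (n : ℕ) (x : D (n + 1)) :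
    h n (δ n (Φ (n + 1) x)) = x - Φ (n + 1) x := by
  have := p.Φ_left n x
  rw [eq_sub_iff_add_eq] at this
  exact eq_sub_of_add_eq' this

theorem h_Φ (p : IsPerturbation d δ dE f g h Φ) (n : ℕ) (x : D n) : h n (Φ n x) = h n x := by
  cases n with
  | zero => rw [p.Φ_zero]
  | succ n => rw [p.Φ_left, map_sub, p.h_h, sub_zero]

theorem f_Φ (p : IsPerturbation d δ dE f g h Φ) (n : ℕ) (x : D n) : f n (Φ n x) = f n x := by
  cases n with
  | zero => rw [p.Φ_zero]
  | succ n => rw [p.Φ_left, map_sub, p.f_h, sub_zero]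

theorem Φ_h (p : IsPerturbation d δ dE f g h Φ) (n : ℕ) (x : D n) :
    Φ (n + 1) (h n x) = h n (x - δ n (Φ (n + 1) (h n x))) := by
  rw [map_sub, ← p.Φ_left]

theorem g_f_succ (p : IsPerturbation d δ dE f g h Φ) (n : ℕ) (x : D (n + 1)) :
    g (n + 1) (f (n + 1) x) = x - d (n + 1) (h (n + 1) x) - h n (d n x) := by
  rw [sub_sub, p.homotopy_succ]
  abel

/-- `1 + δ h` is injective. -/
theorem eq_zero_of_add_eq_zero (p : IsPerturbation d δ dE f g h Φ) (n : ℕ) {y : D n}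
    (hy : y + δ n (h n y) = 0) : y = 0 := by
  -- From δhy = -y follows hδ(hy) = -hy, and Φ(1 + hδ) = 1 then gives hy = Φ(hy - hy) = 0.
  have h1 : h n y = 0 := by
    have h2 := p.Φ_right n (h n y)
    have h3 : h n (δ n (h n y)) = -h n y := by
      rw [← map_neg, eq_neg_of_add_eq_zero_right hy]
    rw [h3, map_neg] at h2
    have h4 : h n y = -Φ (n + 1) (h n y) + Φ (n + 1) (h n y) := by
      rw [h2]; abel
    rw [h4]; abel
  rwa [h1, map_zero, add_zero] at hy

/-- The key identity `A (g f) A + A d + d A = 0` for `A = δ Φ`. -/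
theorem key (p : IsPerturbation d δ dE f g h Φ) (n : ℕ) (x : D (n + 2)) :
    δ n (Φ (n + 1) (g (n + 1) (f (n + 1) (δ (n + 1) (Φ (n + 2) x))))) +
      δ n (Φ (n + 1) (d (n + 1) x)) + d n (δ (n + 1) (Φ (n + 2) x)) = 0 := by
  -- With x = (1 + hδ)w, Φx is w, so the outer occurrences of the series disappear.
  obtain ⟨w, rfl⟩ : ∃ w, w + h (n + 1) (δ (n + 1) w) = x :=
    ⟨Φ (n + 2) x, by rw [p.h_δ_Φ]; abel⟩
  have h1 : Φ (n + 2) (w + h (n + 1) (δ (n + 1) w)) = w := by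
    rw [map_add, p.Φ_right]; abel
  have hdd := p.pert_d_d n w
  rw [h1]
  -- Since (1 + δh)δΦ = δ, applying the injective map 1 + δh removes the remaining series; with gf =
  -- 1 - dh - hd, what is left is dδw + δdw + δδw = 0.
  refine p.eq_zero_of_add_eq_zero n ?_
  have h2 : ∀ u : D (n + 1), δ n (Φ (n + 1) u) + δ n (h n (δ n (Φ (n + 1) u))) = δ n u := by
    intro u
    rw [p.h_δ_Φ, map_sub]
    abel
  have h3 : ∀ a b c : D n, (a + b + c) + δ n (h n (a + b + c)) =
      (a + δ n (h n a)) + (b + δ n (h n b)) + (c + δ n (h n c)) := by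
    intro a b c
    simp only [map_add]
    abel
  rw [h3, h2, h2, p.g_f_succ]
  simp only [map_add, map_sub, p.d_d, zero_add] at hdd ⊢
  rw [← hdd]
  abel

/-- The perturbed map `f`. -/
theorem map_d (p : IsPerturbation d δ dE f g h Φ) (n : ℕ) (x : D (n + 1)) :
    f n ((d n x + δ n x) - δ n (Φ (n + 1) (h n (d n x + δ n x)))) =
      dE n (f (n + 1) (x - δ (n + 1) (Φ (n + 2) (h (n + 1) x)))) +
      f n (δ n (Φ (n + 1) (g (n + 1)
        (f (n + 1) (x - δ (n + 1) (Φ (n + 2) (h (n + 1) x))))))) := by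
  have hk := congrArg (f n) (p.key n (h (n + 1) x))
  rw [map_add (h n), map_add (Φ (n + 1)), p.Φ_right]
  simp only [map_sub (f (n + 1)), map_sub (g (n + 1))]
  rw [p.g_f_succ n x]
  simp only [map_add, map_sub, ← p.f_d, map_zero] at hk ⊢
  linear_combination (norm := abel) hk

/-- The perturbed map `g`. -/
theorem d_map (p : IsPerturbation d δ dE f g h Φ) (n : ℕ) (y : E (n + 1)) :
    d n (Φ (n + 1) (g (n + 1) y)) + δ n (Φ (n + 1) (g (n + 1) y)) =
      Φ n (g n (dE n y + f n (δ n (Φ (n + 1) (g (n + 1) y))))) := by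
  cases n with
  | zero =>
    have h1 : g 0 (f 0 (δ 0 (Φ 1 (g 1 y)))) =
        δ 0 (Φ 1 (g 1 y)) - d 0 (h 0 (δ 0 (Φ 1 (g 1 y)))) := by
      rw [p.homotopy_zero]; abel
    rw [p.Φ_zero, map_add, h1, p.g_d, p.h_δ_Φ, map_sub]
    abel
  | succ n =>
    have hk := congrArg (h n) (p.key n (g (n + 2) y))
    rw [p.Φ_left n, map_add, p.g_d]
    simp only [map_add]
    have h1 := p.g_f_succ n (δ (n + 1) (Φ (n + 2) (g (n + 2) y)))
    rw [p.h_δ_Φ, map_sub] at h1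
    simp only [map_add, map_zero] at hk
    linear_combination (norm := abel) hk - h1

theorem map_map (p : IsPerturbation d δ dE f g h Φ) (n : ℕ) (y : E n) :
    f n (Φ n (g n y) - δ n (Φ (n + 1) (h n (Φ n (g n y))))) = y := by
  rw [p.h_Φ, p.h_g, map_zero, map_zero, sub_zero, p.f_Φ, p.f_g]

/-- The perturbed homotopy is Φh. Degree 0 is enough for the transport, where it shows that the new
augmentation splits. -/
theorem map_map_zero (p : IsPerturbation d δ dE f g h Φ) (x : D 0) :
    Φ 0 (g 0 (f 0 (x - δ 0 (Φ 1 (h 0 x))))) =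
      x - (d 0 (Φ 1 (h 0 x)) + δ 0 (Φ 1 (h 0 x))) := by
  have h1 : ∀ x, g 0 (f 0 x) = x - d 0 (h 0 x) := fun x => by
    rw [p.homotopy_zero]; abel
  rw [p.Φ_zero, h1, ← p.Φ_h]
  abel

end IsPerturbation

end PerturbationLemma

/-! ### Faces of a simplex with an entry appended -/

section TwistedFaces

variable {G : Type*} [Group G]

theorem face_castSucc_castSucc_snoc {n : ℕ} (j : Fin (n + 1)) (x : Fin (n + 1) → G) (g : G) :
    face j.castSucc.castSucc (Fin.snoc x g : Fin (n + 2) → G) =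
      Fin.snoc (face j.castSucc x) g := by
  cases j using Fin.cases with
  | zero =>
    ext k
    simp only [Fin.castSucc_zero, face_zero]
    cases k using Fin.lastCases with
    | last => rw [Fin.succ_last, Fin.snoc_last, Fin.snoc_last]
    | cast k => rw [Fin.succ_castSucc, Fin.snoc_castSucc, Fin.snoc_castSucc]
  | succ j =>
    rw [← Fin.succ_castSucc, ← Fin.succ_castSucc, face_succ, face_succ]
    ext k
    cases k using Fin.lastCases with
    | last =>
      rw [Fin.snoc_last, Fin.contractNth_apply_of_gt _ _ _ _ (by simp), Fin.succ_last,
        Fin.snoc_last]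
    | cast k =>
      rw [Fin.snoc_castSucc]
      simp only [Fin.contractNth, Fin.val_castSucc, Fin.succ_castSucc, Fin.snoc_castSucc]

theorem face_castSucc_last_snoc {n : ℕ} (x : Fin (n + 1) → G) (g : G) :
    face (Fin.last (n + 1)).castSucc (Fin.snoc x g : Fin (n + 2) → G) =
      Fin.snoc (Fin.init x) (x (Fin.last n) * g) := by
  rw [← Fin.succ_last, ← Fin.succ_castSucc, face_succ]
  ext k
  cases k using Fin.lastCases with
  | last =>
    rw [Fin.snoc_last, Fin.contractNth_apply_of_eq _ _ _ _ (by simp), Fin.succ_last,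
      Fin.snoc_last, Fin.snoc_castSucc]
  | cast k =>
    rw [Fin.snoc_castSucc, Fin.contractNth_apply_of_lt _ _ _ _ (by simp), Fin.snoc_castSucc]
    rfl

end TwistedFaces

/-! ### The contractible complex of the universal bundle -/

section TwistedComplex

variable (G : Type*) [Group G]

/-- The complex `ℤG ⊗_t C_*(K(G,1))` of the universal bundle. -/
def twRes : ResData G (fun n => ZG G ⊗[ℤ] Chains G n) where
  d n := (chainDiff G n).baseChange (ZG G) + twPert G n
  ε := twEps G
  hneg := zmultiplesHom _ (1 ⊗ₜ[ℤ] nchain Fin.elim0)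
  h := twHomotopy G

/-- The basis `1 ⊗ [g₁|⋯|gₙ]` of `ℤG ⊗ C_n(K(G,1))`. -/
def twBasis (n : ℕ) : Module.Basis (Simp G n) (ZG G) (ZG G ⊗[ℤ] Chains G n) :=
  Algebra.TensorProduct.basis (ZG G) Finsupp.basisSingleOne

variable {G}

theorem nchain_of_ne {n : ℕ} {x : Fin n → G} (hx : ∀ i, x i ≠ 1) :
    nchain x = Finsupp.single ⟨x, hx⟩ 1 := dif_pos hx

theorem nchain_of_eq {n : ℕ} {x : Fin n → G} {i : Fin n} (hx : x i = 1) :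
    nchain x = 0 := dif_neg fun h => h i hx

theorem smul_twBasis {n : ℕ} (a : ZG G) (x : Simp G n) :
    a • twBasis G n x = a ⊗ₜ[ℤ] nchain x.1 := by
  rw [twBasis, Algebra.TensorProduct.basis_apply, TensorProduct.smul_tmul', smul_eq_mul, mul_one,
    nchain_of_ne x.2]
  simp

theorem twBasis_apply {n : ℕ} (x : Simp G n) : twBasis G n x = 1 ⊗ₜ[ℤ] nchain x.1 := by
  rw [← smul_twBasis, one_smul]

theorem finsuppScalarRight_tmul_single {X : Type*} [DecidableEq X] (a : ZG G) (x : X) :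
    TensorProduct.finsuppScalarRight ℤ (ZG G) (ZG G) X (a ⊗ₜ[ℤ] Finsupp.single x (1 : ℤ)) =
      Finsupp.single x a := by
  erw [TensorProduct.finsuppScalarRight_apply_tmul]
  rw [Finsupp.sum_single_index (by simp), one_smul]

theorem twHomotopy_tmul {n : ℕ} (g : G) (x : Fin n → G) :
    twHomotopy G n (MonoidAlgebra.of ℤ G g ⊗ₜ[ℤ] nchain x) =
      (-1 : ℤ) ^ (n + 1) • ((1 : ZG G) ⊗ₜ[ℤ] nchain (Fin.snoc x g⁻¹ : Fin (n + 1) → G)) := by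
  classical
  by_cases hx : ∀ i, x i ≠ 1
  · rw [nchain_of_ne hx]
    refine (congrArg (wordsLift fun (g : G) (x : Simp G n) =>
      (-1 : ℤ) ^ (n + 1) • ((1 : ZG G) ⊗ₜ[ℤ] (nchain (Fin.snoc x.1 g⁻¹) : Chains G (n + 1))))
      (finsuppScalarRight_tmul_single _ _)).trans ?_
    rw [wordsLift_single]
  · push Not at hx
    obtain ⟨i, hi⟩ := hx
    rw [nchain_of_eq hi, TensorProduct.tmul_zero, map_zero,
      nchain_of_eq (i := i.castSucc) (by rwa [Fin.snoc_castSucc]), TensorProduct.tmul_zero,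
      smul_zero]

theorem twEps_tmul (g : G) (x : Fin 0 → G) :
    twEps G (MonoidAlgebra.of ℤ G g ⊗ₜ[ℤ] nchain x) = 1 := by
  classical
  have hx : ∀ i, x i ≠ 1 := fun i => i.elim0
  rw [nchain_of_ne hx]
  refine (congrArg (wordsLift fun _ _ => (1 : ℤ)) (finsuppScalarRight_tmul_single _ _)).trans ?_
  rw [wordsLift_single]

/-- The part -g of the perturbation cancels the untwisted last face, and only the twisted one
remains. -/
theorem twRes_d_tmul {n : ℕ} (a : ZG G) {x : Fin (n + 1) → G} (hx : ∀ i, x i ≠ 1) :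
    (twRes G).d n (a ⊗ₜ[ℤ] nchain x) =
      ∑ i : Fin (n + 1), (-1 : ℤ) ^ (i : ℕ) • (a ⊗ₜ[ℤ] nchain (face i.castSucc x)) +
        (-1 : ℤ) ^ (n + 1) •
          ((a * MonoidAlgebra.of ℤ G (x (Fin.last n))⁻¹) ⊗ₜ[ℤ] nchain (Fin.init x)) := by
  have hf : ∀ i, faceMap G n i (Finsupp.single ⟨x, hx⟩ 1) = nchain (face i x) := by
    simp [faceMap]
  rw [nchain_of_ne hx]
  change (chainDiff G n).baseChange (ZG G) _ + twPert G n _ = _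
  rw [twPert_tmul_single, LinearMap.baseChange_tmul, chainDiff, Fin.sum_univ_castSucc,
    LinearMap.add_apply, LinearMap.sum_apply, TensorProduct.tmul_add, TensorProduct.tmul_sum]
  simp only [LinearMap.smul_apply, lastFace, hf, face_succ_last, TensorProduct.tmul_smul,
    Fin.val_castSucc, Fin.val_last, mul_sub, mul_one, TensorProduct.sub_tmul, smul_sub]
  abel

theorem twRes_homotopy_zero (y : ZG G ⊗[ℤ] Chains G 0) :
    (twRes G).hneg ((twRes G).ε y) + (twRes G).d 0 ((twRes G).h 0 y) = y := by
  refine DFunLike.congr_fun (addMonoidHom_ext_words (twBasis G 0)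
    (φ := (twRes G).hneg.comp (twRes G).ε +
      ((twRes G).d 0).toAddMonoidHom.comp ((twRes G).h 0))
    (ψ := AddMonoidHom.id _) fun g x => ?_) y
  change (twRes G).hneg (twEps G _) + (twRes G).d 0 (twHomotopy G 0 _) = _
  rw [smul_twBasis, twEps_tmul, twHomotopy_tmul]
  have h0 : ∀ y : Fin 0 → G, y = x.1 := fun y => Subsingleton.elim _ _
  have h1 : (twRes G).hneg 1 = 1 ⊗ₜ[ℤ] nchain x.1 := by
    simp [twRes, h0 Fin.elim0]
  rw [h1, AddMonoidHom.id_apply]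
  by_cases hg : g = 1
  · subst hg
    rw [nchain_of_eq (i := 0) (x := Fin.snoc x.1 1⁻¹) (by simp [Fin.snoc]),
      TensorProduct.tmul_zero, smul_zero, map_zero, map_one, add_zero]
  · rw [map_zsmul, twRes_d_tmul _ (by
      intro i; rw [Fin.fin_one_eq_zero i]; simpa [Fin.snoc] using hg)]
    have h2 : (Fin.snoc x.1 g⁻¹ : Fin 1 → G) (Fin.last 0) = g⁻¹ := Fin.snoc_last _ _
    rw [h0 (Fin.init (Fin.snoc x.1 g⁻¹ : Fin 1 → G)), h2]
    simp [h0 (face _ _)]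

theorem twRes_homotopy_succ (n : ℕ) (y : ZG G ⊗[ℤ] Chains G (n + 1)) :
    (twRes G).h n ((twRes G).d n y) + (twRes G).d (n + 1) ((twRes G).h (n + 1) y) = y := by
  refine DFunLike.congr_fun (addMonoidHom_ext_words (twBasis G (n + 1))
    (φ := ((twRes G).h n).comp ((twRes G).d n).toAddMonoidHom +
      ((twRes G).d (n + 1)).toAddMonoidHom.comp ((twRes G).h (n + 1)))
    (ψ := AddMonoidHom.id _) fun g x => ?_) y
  change twHomotopy G n ((twRes G).d n _) + (twRes G).d (n + 1) (twHomotopy G (n + 1) _) = _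
  rw [smul_twBasis, AddMonoidHom.id_apply, twHomotopy_tmul, twRes_d_tmul _ x.2, ← map_mul, map_add,
    map_sum]
  simp only [map_zsmul, twHomotopy_tmul]
  have hsign : (-1 : ℤ) ^ (n + 1) * (-1 : ℤ) ^ (n + 1) = 1 := by
    rw [← mul_pow]; simp
  rw [smul_smul ((-1 : ℤ) ^ (n + 1)), hsign, one_smul, mul_inv_rev, inv_inv]
  -- For g = 1 appending g⁻¹ gives a degenerate simplex, and only the twisted last face contributes:
  -- s puts the deleted last entry back from its coefficient.
  by_cases hg : g = 1
  · subst hg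
    have h0 : ∀ {m : ℕ} (z : Fin m → G),
        nchain (Fin.snoc z 1 : Fin (m + 1) → G) = 0 :=
      fun z => nchain_of_eq (i := Fin.last _) (by rw [Fin.snoc_last])
    simp only [inv_one, h0, TensorProduct.tmul_zero, smul_zero, Finset.sum_const_zero, map_zero,
      add_zero, zero_add, mul_one, map_one]
    have := Fin.snoc_init_self x.1
    rw [this]
  · rw [twRes_d_tmul _ (by
        intro i
        cases i using Fin.lastCases with
        | last => rw [Fin.snoc_last]; simpa using hg
        | cast i => rw [Fin.snoc_castSucc]; exact x.2 i), Fin.sum_univ_castSucc (n := n + 1)]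
    simp only [face_castSucc_castSucc_snoc, face_castSucc_last_snoc, Fin.snoc_last, inv_inv,
      Fin.init_snoc, one_mul, Fin.val_castSucc, Fin.val_last, smul_add, Finset.smul_sum, smul_smul]
    have h2 : (-1 : ℤ) ^ (n + 1 + 1) * (-1 : ℤ) ^ (n + 1) = -1 := by
      rw [pow_succ, mul_right_comm, hsign, one_mul]
    have h3 : (-1 : ℤ) ^ (n + 1 + 1) * (-1 : ℤ) ^ (n + 1 + 1) = 1 := by
      rw [← mul_pow]; simp
    have h4 : ∀ i : ℕ, (-1 : ℤ) ^ (n + 1 + 1) * (-1 : ℤ) ^ i =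
        -((-1 : ℤ) ^ i * (-1 : ℤ) ^ (n + 1)) := fun i => by ring
    simp only [h2, h3, h4, neg_smul, one_smul, Finset.sum_neg_distrib]
    abel

theorem twRes_isFreeResolution : (twRes G).IsFreeResolution := by
  refine isFreeResolution_of_homotopy (twBasis G) (fun a x => ?_) (fun m => ?_)
    twRes_homotopy_zero twRes_homotopy_succ fun n x => ?_
  · refine map_smul_of_words (twBasis G 0) (twEps G) 1 (fun g z => ?_) a x
    rw [smul_twBasis, twEps_tmul]
    rfl
  · have : (twRes G).hneg m = m • (MonoidAlgebra.of ℤ G 1 ⊗ₜ[ℤ] nchain Fin.elim0) := by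
      rw [map_one]
      simp [twRes]
    rw [this, map_zsmul]
    change m • twEps G _ = m
    rw [twEps_tmul, smul_eq_mul, mul_one]
  · refine ⟨(-1 : ℤ) ^ (n + 1) • (MonoidAlgebra.of ℤ G (x.1 (Fin.last n))⁻¹ ⊗ₜ[ℤ]
      nchain (Fin.init x.1)), ?_⟩
    rw [map_zsmul]
    change _ = _ • twHomotopy G n _
    rw [twHomotopy_tmul, smul_smul, ← mul_pow, inv_inv, Fin.snoc_init_self x.1, twBasis_apply]
    simp

end TwistedComplex

/-! ### Transport of the contraction -/

section Transport

variable {G : Type*} [Group G] {C D E : ℕ → Type*}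
  [∀ n, AddCommGroup (C n)] [∀ n, Module (ZG G) (C n)]
  [∀ n, AddCommGroup (D n)] [∀ n, Module (ZG G) (D n)]
  [∀ n, AddCommGroup (E n)] [∀ n, Module (ZG G) (E n)]

/-- The perturbation `g τ f` of a differential `d`, where `τ` perturbs `dE`. -/
theorem IsLinearReduction.pert_d_d {A : Type*} [Ring A] {D E : ℕ → Type*}
    [∀ n, AddCommGroup (D n)] [∀ n, Module A (D n)] [∀ n, AddCommGroup (E n)]
    [∀ n, Module A (E n)] {d δ : ∀ n, D (n + 1) →ₗ[A] D n} {dE τ : ∀ n, E (n + 1) →ₗ[A] E n}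
    {f : ∀ n, D n →ₗ[A] E n} {g : ∀ n, E n →ₗ[A] D n} {h : ∀ n, D n →ₗ[A] D (n + 1)}
    (r : IsLinearReduction d dE f g h) (d_d : ∀ n x, d n (d (n + 1) x) = 0)
    (dE_dE : ∀ n x, dE n (dE (n + 1) x) = 0)
    (hτ : ∀ n x, dE n (dE (n + 1) x + τ (n + 1) x) + τ n (dE (n + 1) x + τ (n + 1) x) = 0)
    (hδ : ∀ n x, δ n x = g n (τ n (f (n + 1) x))) (n : ℕ) (x : D (n + 2)) :
    d n (d (n + 1) x + δ (n + 1) x) + δ n (d (n + 1) x + δ (n + 1) x) = 0 := by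
  have ht := congrArg (g n) (hτ n (f (n + 2) x))
  rw [map_add (dE n), dE_dE, zero_add, map_add, r.g_d, map_zero] at ht
  rw [map_add, d_d, zero_add, hδ n, map_add (f (n + 1)), r.f_d, hδ, r.f_g, ht]

/-- The contracting homotopy of a resolution `T`, with the differential `dC + τ`, is carried along
the equivalence obtained from a reduction `(f₁, g₁, h₁)` to `(C, dC)` and from a reduction
`(f, g, h)` by perturbation with `δ = g₁ τ f₁`. -/
theorem isFreeResolution_of_perturbation {T : ResData G C} (t : T.IsFreeResolution)
    {d δ : ∀ n, D (n + 1) →ₗ[ZG G] D n} {dC τ : ∀ n, C (n + 1) →ₗ[ZG G] C n}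
    {dE : ∀ n, E (n + 1) →ₗ[ZG G] E n}
    {f₁ : ∀ n, D n →ₗ[ZG G] C n} {g₁ : ∀ n, C n →ₗ[ZG G] D n} {h₁ : ∀ n, D n →ₗ[ZG G] D (n + 1)}
    (r : IsLinearReduction d dC f₁ g₁ h₁) (hT : ∀ n x, T.d n x = dC n x + τ n x)
    {f : ∀ n, D n →ₗ[ZG G] E n} {g : ∀ n, E n →ₗ[ZG G] D n} {h : ∀ n, D n →ₗ[ZG G] D (n + 1)}
    (r₂ : IsLinearReduction d dE f g h) (d_d : ∀ n x, d n (d (n + 1) x) = 0)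
    (dC_dC : ∀ n x, dC n (dC (n + 1) x) = 0) (hδ : ∀ n x, δ n x = g₁ n (τ n (f₁ (n + 1) x)))
    {Φ : ∀ n, D n →ₗ[ZG G] D n} (Φ_zero : ∀ x, Φ 0 x = x)
    (Φ_left : ∀ n x, h n (δ n (Φ (n + 1) x)) = x - Φ (n + 1) x)
    (Φ_right : ∀ n x, Φ (n + 1) (h n (δ n x)) = x - Φ (n + 1) x)
    {N : ResData G E} (hNd : ∀ n x, N.d n x = dE n x + f n (δ n (Φ (n + 1) (g (n + 1) x))))
    (hNε : ∀ x, N.ε x = T.ε (f₁ 0 (Φ 0 (g 0 x))))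
    (hNhneg : ∀ m, N.hneg m = f 0 (g₁ 0 (T.hneg m) - δ 0 (Φ 1 (h 0 (g₁ 0 (T.hneg m))))))
    (hNh : ∀ n x, N.h n x = f (n + 1)
      ((h₁ n (Φ n (g n x)) + g₁ (n + 1) (T.h n (f₁ n (Φ n (g n x))))) -
        δ (n + 1) (Φ (n + 2) (h (n + 1)
          (h₁ n (Φ n (g n x)) + g₁ (n + 1) (T.h n (f₁ n (Φ n (g n x)))))))))
    (free : ∀ n, Module.Free (ZG G) (E n)) : N.IsFreeResolution := by
  have p : IsPerturbation d δ dE f g h Φ :=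
    ⟨r₂, d_d, r.pert_d_d d_d dC_dC (fun n x => by rw [← hT, ← hT, t.d_d]) hδ, Φ_zero,
      fun n x => by rw [Φ_left, sub_sub_cancel], Φ_right⟩
  -- the perturbed maps
  obtain ⟨d', hd'⟩ : ∃ d' : ∀ n, D (n + 1) →+ D n, ∀ n x, d' n x = d n x + δ n x :=
    ⟨fun n => (d n + δ n).toAddMonoidHom, fun _ _ => rfl⟩
  obtain ⟨Fm, hF⟩ : ∃ Fm : ∀ n, D n →+ E n, ∀ n x, Fm n x = f n (x - δ n (Φ (n + 1) (h n x))) :=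
    ⟨fun n => (f n ∘ₗ (LinearMap.id - δ n ∘ₗ Φ (n + 1) ∘ₗ h n)).toAddMonoidHom, fun _ _ => rfl⟩
  obtain ⟨Gm, hG⟩ : ∃ Gm : ∀ n, E n →ₗ[ZG G] D n, ∀ n x, Gm n x = Φ n (g n x) :=
    ⟨fun n => Φ n ∘ₗ g n, fun _ _ => rfl⟩
  -- H contracts the perturbed complex D: h₁ accounts for 1 - g₁f₁, and g₁ T.h f₁ for g₁f₁.
  obtain ⟨H, hH⟩ : ∃ H : ∀ n, D n → D (n + 1), ∀ n x,
      H n x = h₁ n x + g₁ (n + 1) (T.h n (f₁ n x)) := ⟨_, fun _ _ => rfl⟩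
  have f₁_d : ∀ n x, f₁ n (d' n x) = T.d n (f₁ (n + 1) x) := fun n x => by
    rw [hd', hδ, hT, map_add, r.f_g, r.f_d]
  have g₁_d : ∀ n x, g₁ n (T.d n x) = d' n (g₁ (n + 1) x) := fun n x => by
    rw [hd', hδ, hT, map_add, r.f_g, r.g_d]
  -- The side conditions f₁h₁ = 0 and h₁g₁ = 0 hide the perturbation g₁τf₁ from h₁, so ρ₁ needs no
  -- series.
  have d_h₁ : ∀ n x, d' n (h₁ n x) = d n (h₁ n x) := fun n x => by
    rw [hd', hδ, r.f_h, map_zero, map_zero, add_zero]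
  have h₁_d : ∀ n x, h₁ n (d' n x) = h₁ n (d n x) := fun n x => by
    rw [hd', hδ, map_add, r.h_g, add_zero]
  have H_zero : ∀ x, g₁ 0 (T.hneg (T.ε (f₁ 0 x))) + d' 0 (H 0 x) = x := fun x => by
    have h1 := congrArg (g₁ 0) (t.homotopy_zero (f₁ 0 x))
    have h2 := r.homotopy_zero x
    rw [map_add] at h1
    rw [hH, map_add, d_h₁, ← g₁_d]
    linear_combination (norm := abel) h1 + h2
  have H_succ : ∀ n x, H n (d' n x) + d' (n + 1) (H (n + 1) x) = x := fun n x => by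
    have h1 := congrArg (g₁ (n + 1)) (t.homotopy_succ n (f₁ (n + 1) x))
    have h2 := r.homotopy_succ n x
    rw [map_add] at h1
    rw [hH, hH, map_add, d_h₁, h₁_d, ← g₁_d, f₁_d]
    linear_combination (norm := abel) h1 + h2
  have F_d : ∀ n x, Fm n (d' n x) = N.d n (Fm (n + 1) x) := fun n x => by
    rw [hF, hd', hNd, hF, p.map_d]
  have d_G : ∀ n y, d' n (Gm (n + 1) y) = Gm n (N.d n y) := fun n y => by
    rw [hG, hd', hNd, hG, p.d_map]
  have F_G : ∀ n y, Fm n (Gm n y) = y := fun n y => by rw [hF, hG, p.map_map]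
  have G_F : ∀ x, Gm 0 (Fm 0 x) = x - d' 0 (Φ 1 (h 0 x)) := fun x => by
    rw [hF, hG, hd', p.map_map_zero]
  have dd : ∀ n x, d' n (d' (n + 1) x) = 0 := fun n x => by
    rw [hd', hd', p.pert_d_d]
  simp only [← hG, ← hH, ← hF] at hNε hNhneg hNh
  exact
  { free := free
    ε_smul := fun a x => by rw [hNε, hNε, map_smul, map_smul, t.ε_smul]
    ε_d := fun x => by rw [hNε, ← d_G, f₁_d, t.ε_d]
    -- Writing x = FGx moves the question to D. The homotopy identities hold likewise, N.h being
    -- FHG.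
    d_d := fun n x => by rw [← F_G (n + 2) x, ← F_d, ← F_d, dd, map_zero]
    ε_hneg := fun m => by
      rw [hNε, hNhneg, G_F, map_sub, f₁_d, map_sub, t.ε_d, sub_zero, r.f_g, t.ε_hneg]
    homotopy_zero := fun x => by rw [hNhneg, hNh, ← F_d, ← map_add, hNε, H_zero, F_G]
    homotopy_succ := fun n x => by rw [hNh, hNh, ← F_d, ← d_G, ← map_add, H_succ, F_G] }

end Transport

section NewResolution

variable {G : Type u} [Group G] {D : ℕ → Type v} {E : ℕ → Type w} [∀ n, AddCommGroup (D n)]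
  [∀ n, AddCommGroup (E n)] {η : EquivData (Chains G) D E} {dE : ∀ n, E (n + 1) →ₗ[ℤ] E n}

set_option maxHeartbeats 2000000 in
theorem newRes_isFreeResolution (h : η.IsStrongEquiv (chainDiff G) dE) [∀ n, Module.Free ℤ (E n)]
    (hη : ∀ n, LocallyNilpotent (pertEnd η n)) : (newRes η dE hη).IsFreeResolution :=
  isFreeResolution_of_perturbation twRes_isFreeResolution
    (h.ρ₁_isReduction.baseChange (S := ZG G)) (fun _ _ => rfl)
    (h.ρ₂_isReduction.baseChange (S := ZG G)) (h.dD_isDifferential.baseChange (S := ZG G))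
    (h.dC_isDifferential.baseChange (S := ZG G)) (δ := midPert η) (fun _ _ => rfl)
    (Φ := pertSeries η hη) (fun _ => rfl)
    (fun n x => map_altSum_eq_sub (pertEnd η n) (hη n) x)
    (fun n x => altSum_eq_sub (pertEnd η n) (hη n) x) (fun _ _ => rfl) (fun _ => rfl)
    -- `hneg` is given by its value at 1, so ZG-linear maps have to be moved past the integer
    -- multiple m.
    (fun m => by
      refine Eq.trans ?_ (((pertF η hη 0) ∘ₗ (η.ρ₁.g 0).baseChange (ZG G)).map_smul_of_tower m
        (1 ⊗ₜ[ℤ] nchain Fin.elim0)).symm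
      rfl)
    (fun _ _ => rfl) (fun _ => inferInstance)

end NewResolution

end EffHom

end

theorem mainTheorem2 {G : Type*} [Group G] {F : ℕ → Type*} [∀ n, AddCommGroup (F n)]
    [∀ n, Module (EffHom.ZG G) (F n)] {Z : ℕ → Type*} [Unique (Z 0)]
    (b : ∀ n, Module.Basis (Z n) (EffHom.ZG G) (F n))
    (R : EffHom.ResData G F) (hR : R.IsFreeResolution)
    (N : G → ℕ) (hN : EffHom.IsGroupNorm N) (hc : EffHom.NormCompatible b R N) :
    (EffHom.effHom b R).IsStrongEquiv (EffHom.chainDiff G) (EffHom.coinvDiff b R) ∧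
    (∀ n, EffHom.LocallyNilpotent
      ((EffHom.effHom b R).ρ₂.h n ∘ₗ (EffHom.effHom b R).ρ₁.g n ∘ₗ EffHom.lastFace G n ∘ₗ
        (EffHom.effHom b R).ρ₁.f (n + 1))) ∧
    ∃ hη : ∀ n, EffHom.LocallyNilpotent (EffHom.pertEnd (EffHom.effHom b R) n),
      (EffHom.newRes (EffHom.effHom b R) (EffHom.coinvDiff b R) hη).IsFreeResolution ∧
      (∀ n, ∃ e : EffHom.ZG G ⊗[ℤ] (Z n →₀ ℤ) ≃ₗ[EffHom.ZG G] F n,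
        ∀ z, e (1 ⊗ₜ[ℤ] Finsupp.single z 1) = b n z) ∧
      ((∀ n, Finite (Z n)) → ∀ n, Module.Finite ℤ (Z n →₀ ℤ) ∧
        Module.Finite (EffHom.ZG G) (EffHom.ZG G ⊗[ℤ] (Z n →₀ ℤ))) := by
  refine ⟨EffHom.effHom_isStrongEquiv b hR, EffHom.effHom_locallyNilpotent_lastFace b hR hN hc,
    EffHom.effHom_locallyNilpotent_pertEnd b hR hN hc,
    EffHom.newRes_isFreeResolution (EffHom.effHom_isStrongEquiv b hR) _, fun n => ?_,
    fun _ n => ⟨inferInstance, inferInstance⟩⟩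
  refine ⟨(Algebra.TensorProduct.basis (EffHom.ZG G)
    (Finsupp.basisSingleOne (R := ℤ) (ι := Z n))).equiv (b n) (Equiv.refl _), fun z => ?_⟩
  have := (Algebra.TensorProduct.basis (EffHom.ZG G)
    (Finsupp.basisSingleOne (R := ℤ) (ι := Z n))).equiv_apply z (b n) (Equiv.refl _)
  rw [Algebra.TensorProduct.basis_apply] at this
  simpa using this
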